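/- Let $S$ be a normal integral scheme. A $\mathbb{G}_{a,S}$-algebra scheme (unitary, associative, not necessarily commutative) is an $S$-scheme $A$ such that $A(T)$ is a $\Gamma(T,\mathcal{O}_T)$-algebra, functorially in the $S$-scheme $T$; it is finite-dimensional, of dimension $n$, if it is, as a $\mathbb{G}_{a,S}$-module scheme, isomorphic to $\mathbb{G}_a^n$ locally on $S$. Sections of $\mathrm{Sym}^d(A^\vee)$ are viewed as functions $A\to\mathbb{G}_{a,S}$, homogeneous of degree $d$. A determinant of $A$, of degree $d$, is a section $\det_{A/S}$ of $\mathrm{Sym}^d(A^\vee)$, where $d$ is the least integer such that the morphism $A\to\wedge^{d+1}A$, $a\mapsto 1\wedge a\wedge\dots\wedge a^d$, is zero, such that (i) $\det_{A/S}\colon A\to\mathbb{G}_{a,S}$ is a morphism of multiplicative unitary monoid schemes, and (ii) for every point $a$ of $A$, the polynomial $P(X)=\det_{A/S}(X-a)$ satisfies $P(a)=0$. (1) Let $f\colon A\to B$ be a surjective homomorphism of finite-dimensional $\mathbb{G}_{a,S}$-algebra schemes with determinants $\det_{A/S}\in\mathrm{Sym}^d(A^\vee)$ and $\det_{B/S}\in\mathrm{Sym}^e(B^\vee)$.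 Then $e\le d$, and there exists a unique section $\det_{A/B/S}$ of $\mathrm{Sym}^{d-e}(A^\vee)$ such that $\det_{A/S}=\det_{A/B/S}\cdot f^*\det_{B/S}$. Moreover $\det_{A/B/S}\colon A\to\mathbb{G}_{a,S}$ is a morphism of multiplicative unitary monoid schemes. (2) Let $A$ and $B$ be finite-dimensional $\mathbb{G}_{a,S}$-algebra schemes with determinants $\det_{A/S}$ and $\det_{B/S}$ of degrees $d$ and $e$, and let $C=A\times B$ be the product algebra, with projections $\mathrm{pr}_1\colon C\to A$ and $\mathrm{pr}_2\colon C\to B$. Then $\mathrm{pr}_1^*\det_{A/S}\cdot\mathrm{pr}_2^*\det_{B/S}$ is the unique determinant of $C$, of degree $d+e$; that is, $\det_{C/S}=\mathrm{pr}_1^*\det_{A/S}\cdot\mathrm{pr}_2^*\det_{B/S}$. -/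

import Mathlib

open CategoryTheory AlgebraicGeometry

universe u

noncomputable section

/-- A scheme is normal if all its local rings are integrally closed domains. -/
class IsNormalScheme (S : Scheme.{u}) : Prop where
  isDomain_stalk (s : S) : IsDomain (S.presheaf.stalk s)
  isIntegrallyClosed_stalk (s : S) : IsIntegrallyClosed (S.presheaf.stalk s)

/-- A `𝔾ₐ`-algebra scheme over `S` (unitary and associative, not necessarily commutative): an
`S`-scheme `X` whose functor of points is a functor in algebras over the structure ring scheme
`𝔾ₐ : T ↦ Γ(T, 𝒪_T)`. That is, the set `X(T)` of `T`-points is a `Γ(T, 𝒪_T)`-algebra, naturally in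
the `S`-scheme `T`. (By the Yoneda lemma this is the same as giving the structure morphisms on `X`.)
-/
structure AlgebraScheme (S : Scheme.{u}) where
  /-- the underlying `S`-scheme -/
  X : Over S
  /-- the ring structure on `T`-points -/
  ring (T : Over S) : Ring (T ⟶ X)
  /-- the algebra structure on `T`-points -/
  algebra (T : Over S) : Algebra Γ(T.left, ⊤) (T ⟶ X)
  comp_add {T' T : Over S} (g : T' ⟶ T) (a b : T ⟶ X) : g ≫ (a + b) = g ≫ a + g ≫ b
  comp_mul {T' T : Over S} (g : T' ⟶ T) (a b : T ⟶ X) : g ≫ (a * b) = (g ≫ a) * (g ≫ b)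
  comp_one {T' T : Over S} (g : T' ⟶ T) : g ≫ (1 : T ⟶ X) = 1
  comp_smul {T' T : Over S} (g : T' ⟶ T) (c : Γ(T.left, ⊤)) (a : T ⟶ X) :
    g ≫ (c • a) = g.left.appTop.hom c • (g ≫ a)

namespace AlgebraScheme

attribute [instance] AlgebraScheme.ring AlgebraScheme.algebra

variable {S : Scheme.{u}}

/-- A homomorphism of `𝔾ₐ`-algebra schemes: a morphism of `S`-schemes which is a homomorphism of
unitary algebras on `T`-points for all `T`. -/
structure Hom (A B : AlgebraScheme S) where
  /-- the underlying morphism of `S`-schemes -/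
  hom : A.X ⟶ B.X
  map_add {T : Over S} (a b : T ⟶ A.X) : (a + b) ≫ hom = a ≫ hom + b ≫ hom
  map_mul {T : Over S} (a b : T ⟶ A.X) : (a * b) ≫ hom = (a ≫ hom) * (b ≫ hom)
  map_one {T : Over S} : (1 : T ⟶ A.X) ≫ hom = 1
  map_smul {T : Over S} (c : Γ(T.left, ⊤)) (a : T ⟶ A.X) : (c • a) ≫ hom = c • (a ≫ hom)

section product

open MonoidalCategory CartesianMonoidalCategory

/-- `T`-points of `A ×_S B` are pairs of `T`-points. -/
def prodPoints (A B : AlgebraScheme S) (T : Over S) :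
    (T ⟶ A.X ⊗ B.X) ≃ (T ⟶ A.X) × (T ⟶ B.X) where
  toFun c := (c ≫ fst A.X B.X, c ≫ snd A.X B.X)
  invFun p := lift p.1 p.2
  left_inv c := by simp [← comp_lift]
  right_inv p := by simp

/-- The product algebra `A × B`: the underlying scheme is `A ×_S B`, and the operations on
`(A × B)(T) = A(T) × B(T)` are componentwise. -/
def prod (A B : AlgebraScheme S) : AlgebraScheme S where
  X := A.X ⊗ B.X
  ring T := (prodPoints A B T).ring
  algebra T :=
    letI := (prodPoints A B T).ring
    (prodPoints A B T).algebra Γ(T.left, ⊤)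
  comp_add {T' T} g a b := by
    apply (prodPoints A B T').injective
    simp [Equiv.add_def, prodPoints, A.comp_add, B.comp_add]
  comp_mul {T' T} g a b := by
    apply (prodPoints A B T').injective
    simp [Equiv.mul_def, prodPoints, A.comp_mul, B.comp_mul]
  comp_one {T' T} g := by
    apply (prodPoints A B T').injective
    simp [Equiv.one_def, prodPoints, A.comp_one, B.comp_one]
  comp_smul {T' T} g c a := by
    apply (prodPoints A B T').injective
    simp [Equiv.smul_def, prodPoints, A.comp_smul, B.comp_smul]

/-- The projection of the product algebra `A × B` to `A`. -/
def prodFst (A B : AlgebraScheme S) : Hom (A.prod B) A where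
  hom := fst A.X B.X
  map_add {T} _ _ := congrArg Prod.fst ((prodPoints A B T).apply_symm_apply _)
  map_mul {T} _ _ := congrArg Prod.fst ((prodPoints A B T).apply_symm_apply _)
  map_one {T} := congrArg Prod.fst ((prodPoints A B T).apply_symm_apply _)
  map_smul {T} _ _ := congrArg Prod.fst ((prodPoints A B T).apply_symm_apply _)

/-- The projection of the product algebra `A × B` to `B`. -/
def prodSnd (A B : AlgebraScheme S) : Hom (A.prod B) B where
  hom := snd A.X B.X
  map_add {T} _ _ := congrArg Prod.snd ((prodPoints A B T).apply_symm_apply _)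
  map_mul {T} _ _ := congrArg Prod.snd ((prodPoints A B T).apply_symm_apply _)
  map_one {T} := congrArg Prod.snd ((prodPoints A B T).apply_symm_apply _)
  map_smul {T} _ _ := congrArg Prod.snd ((prodPoints A B T).apply_symm_apply _)

end product

variable (A : AlgebraScheme S)

/-- A frame of `A` over an `S`-scheme `V` is a family of `V`-points `e₁, …, eₙ` of `A` such that
`(c₁, …, cₙ) ↦ c₁ e₁ + ⋯ + cₙ eₙ` is an isomorphism from `𝔾ₐⁿ` to `A` over `V`, i.e. such that the
pullbacks of the `eᵢ` to any `T ⟶ V` are a basis of the `Γ(T, 𝒪_T)`-module `A(T)`. -/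
def IsFrame {V : Over S} {n : ℕ} (e : Fin n → (V ⟶ A.X)) : Prop :=
  ∀ ⦃T : Over S⦄ (g : T ⟶ V),
    LinearIndependent Γ(T.left, ⊤) (fun i => g ≫ e i) ∧
      Submodule.span Γ(T.left, ⊤) (Set.range fun i => g ≫ e i) = ⊤

/-- `A` is an `n`-dimensional algebra scheme: its underlying `𝔾ₐ`-module scheme is a vector bundle of
rank `n`, i.e. it is isomorphic to `𝔾ₐⁿ` locally on `S`. -/
def IsOfDim (n : ℕ) : Prop :=
  ∀ s : S, ∃ U : S.Opens, s ∈ U ∧ ∃ e : Fin n → (Over.mk U.ι ⟶ A.X), A.IsFrame e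

/-- The value `δ(a) ∈ 𝔾ₐ(T)` of a function `δ : A ⟶ 𝔾ₐ` at a `T`-point `a` of `A`. -/
def value {A : AlgebraScheme S} (δ : Γ(A.X.left, ⊤)) {T : Over S} (a : T ⟶ A.X) : Γ(T.left, ⊤) :=
  a.left.appTop.hom δ

/-- The pullback `f^* δ` of a function `δ` on `B` along `f : A ⟶ B`. -/
def Hom.pullback {A B : AlgebraScheme S} (f : Hom A B) (δ : Γ(B.X.left, ⊤)) : Γ(A.X.left, ⊤) :=
  f.hom.left.appTop.hom δ

/-- The function `δ` on `A` is a section of `Sym^d(A^∨)`. For a frame `e₁, …, eₙ` of `A` over an open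
`U` with dual frame `t₁, …, tₙ`, the restriction to `U` of the sheaf `Sym^d(A^∨)` consists of the
homogeneous polynomials of degree `d` in `t₁, …, tₙ`; so the condition is that locally on `S` there
is a frame in which `δ` is given by a homogeneous polynomial of degree `d` in the coordinates. -/
def IsSymSection (d : ℕ) (δ : Γ(A.X.left, ⊤)) : Prop :=
  ∀ s : S, ∃ U : S.Opens, s ∈ U ∧ ∃ (n : ℕ) (e : Fin n → (Over.mk U.ι ⟶ A.X)), A.IsFrame e ∧
    ∃ p : MvPolynomial (Fin n) Γ((U : Scheme.{u}), ⊤), p.IsHomogeneous d ∧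
      ∀ ⦃T : Over S⦄ (g : T ⟶ Over.mk U.ι) (c : Fin n → Γ(T.left, ⊤)),
        value δ (∑ i, c i • (g ≫ e i)) = p.eval₂ g.left.appTop.hom c

/-- The function `δ : A ⟶ 𝔾ₐ` is a morphism of multiplicative unitary monoid schemes. -/
def IsMonoidMorphism (δ : Γ(A.X.left, ⊤)) : Prop :=
  ∀ T : Over S, value δ (1 : T ⟶ A.X) = 1 ∧ ∀ a b : T ⟶ A.X, value δ (a * b) = value δ a * value δ b

/-- The degree of algebraicity of `A` is at most `d`: the morphism `A ⟶ ⋀^{d+1} A`,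
`a ↦ 1 ∧ a ∧ ⋯ ∧ a ^ d` is zero. (A morphism of schemes is determined by its effect on `T`-points
with `T` affine, and for those `(⋀^{d+1} A)(T)` is the exterior power of the module `A(T)`.) -/
def DegLE (d : ℕ) : Prop :=
  ∀ (T : Over S) [IsAffine T.left] (a : T ⟶ A.X),
    exteriorPower.ιMulti Γ(T.left, ⊤) (d + 1) (fun i : Fin (d + 1) => a ^ (i : ℕ)) = 0

/-- The affine line over an `S`-scheme `T`, as an `S`-scheme. -/
def line (T : Over S) : Over S :=
  Over.mk ((𝔸(PUnit.{u + 1}; T.left) ↘ T.left) ≫ T.hom)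

/-- The projection from the affine line over `T` to `T`. -/
def lineProj (T : Over S) : line T ⟶ T :=
  Over.homMk (𝔸(PUnit.{u + 1}; T.left) ↘ T.left)

/-- The coordinate of the affine line over `T`. -/
def lineCoord (T : Over S) : Γ((line T).left, ⊤) :=
  AffineSpace.coord T.left PUnit.unit

/-- For all points `a` of `A`, the value at `a` of the polynomial `P(X) = δ(X - a)` is zero.
Here `T` is affine, `a ∈ A(T)`, and `P` is the polynomial with coefficients in `Γ(T, 𝒪_T)` which,
seen as a function on the affine line over `T` with coordinate `X`, is `δ(X - a)`. -/
def IsCancelling (δ : Γ(A.X.left, ⊤)) : Prop :=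
  ∀ (T : Over S) [IsAffine T.left] (a : T ⟶ A.X),
    ∃ P : Polynomial Γ(T.left, ⊤),
      P.eval₂ (lineProj T).left.appTop.hom (lineCoord T) =
        value δ (lineCoord T • (1 : line T ⟶ A.X) - lineProj T ≫ a) ∧
      Polynomial.aeval a P = 0

/-- `δ` is the determinant of `A`, and `d` is its degree: `d` is the least integer such that
`a ↦ 1 ∧ a ∧ ⋯ ∧ a ^ d` is zero, and `δ` is a section of `Sym^d(A^∨)` which is a morphism of
multiplicative unitary monoid schemes and such that the polynomial `δ(X - a)` cancels `a`. -/
structure IsDeterminant (d : ℕ) (δ : Γ(A.X.left, ⊤)) : Prop where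
  isLeast : IsLeast {k : ℕ | A.DegLE k} d
  isSymSection : A.IsSymSection d δ
  isMonoidMorphism : A.IsMonoidMorphism δ
  isCancelling : A.IsCancelling δ

end AlgebraScheme

end

/-!
Let `A` be a finite-dimensional algebra scheme over the normal integral scheme `S`. Its total space is
locally an affine space over `S`, so it is integral, and the rings of functions of its restrictions to
the affine opens of `S` with a frame are polynomial rings over integrally closed domains, hence
integrally closed (`IsFrame.isIntegrallyClosed_restrictTo`). By Gauss's lemma the minimal polynomial of
the generic point of `A` over the function field of `A` has its coefficients in these rings
(`IsMinimalPolynomial.exists_of_isIntegrallyClosed`); as minimal polynomials are unique, the local ones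
glue to a monic polynomial `μ_A` whose coefficients are functions on `A`, the generic minimal
polynomial (`IsOfDim.exists_isGenericPolynomial`). It is the minimal polynomial of every dominant point
of `A` with values in an integral scheme.

The degree of algebraicity of `A` is the degree `d` of `μ_A` (`IsGenericPolynomial.degLE_iff`). If `δ`
is a determinant, then for the generic point `a` the polynomial `δ(X - a)` is monic of degree `d`,
since `δ` is homogeneous of degree `d` and `δ(1) = 1`, and it cancels `a`. Hence it is `μ_A`, so that
`δ(x - a) = μ_A(x; a)` for all points (`IsDeterminant.value_smul_one_sub`). In particular
`δ(a) = μ_A(0; -a)`, and the determinant is unique (`IsDeterminant.unique`).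

For a surjective homomorphism `f : A ⟶ B`, the image of the generic point of `A` is a dominant point of
`B` which is cancelled by `μ_A`, so `f^* μ_B` divides `μ_A`; evaluation at `0` of the quotient gives the
quotient of the determinants (`IsDeterminant.exists_eq_mul_pullback`). The quotient is unique, homogeneous
and multiplicative because `A` and `A × A` are integral and the determinant of `B` is not zero at the unit
section (`IsSymSection.of_mul`, `IsMonoidMorphism.of_mul`).

For a product `A × B`, the pullbacks of `μ_A` and `μ_B` divide `μ_{A × B}`, and their product cancels the
generic point. They are coprime over the function field, because at the point `(0, 1)` they become
`X ^ d` and `(X - 1) ^ e`, so that their resultant is not zero (`IsDeterminant.resultant_ne_zero`). Hence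
`μ_{A × B}` is their product, of degree `d + e` (`IsDeterminant.isLeast_degLE_prod`), and the other
properties of the product of the two determinants are immediate (`IsDeterminant.prod`).
-/

noncomputable section

/-! ### Minimal polynomials, exterior powers and homogeneous polynomials -/

open Polynomial in
/-- The monic polynomial `μ` generates the ideal of the polynomials that cancel `a`. -/
structure IsMinimalPolynomial {D Λ : Type*} [CommRing D] [Ring Λ] [Algebra D Λ] (a : Λ)
    (μ : D[X]) : Prop where
  monic : μ.Monic
  aeval_eq_zero : aeval a μ = 0
  dvd_of_aeval_eq_zero : ∀ P : D[X], aeval a P = 0 → μ ∣ P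

namespace IsMinimalPolynomial

open Polynomial

lemma unique {D Λ : Type*} [CommRing D] [IsDomain D] [Ring Λ] [Algebra D Λ] {a : Λ} {μ ν : D[X]}
    (hμ : IsMinimalPolynomial a μ) (hν : IsMinimalPolynomial a ν) : μ = ν :=
  have h1 := hμ.dvd_of_aeval_eq_zero ν hν.aeval_eq_zero
  have h2 := hν.dvd_of_aeval_eq_zero μ hμ.aeval_eq_zero
  eq_of_monic_of_associated hμ.monic hν.monic (associated_of_dvd_dvd h1 h2)

/-- Over an integrally closed domain, the minimal polynomial over the fraction field of an element
of a finite free algebra has its coefficients in the domain, by Gauss's lemma. -/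
lemma exists_of_isIntegrallyClosed {D Λ : Type*} [CommRing D] [IsDomain D] [IsIntegrallyClosed D]
    [Ring Λ] [Algebra D Λ] [Module.Finite D Λ] [Module.Free D Λ] (a : Λ) :
    ∃ μ : D[X], IsMinimalPolynomial a μ := by
  let K := FractionRing D
  let i : Λ →ₐ[D] TensorProduct D K Λ := Algebra.TensorProduct.includeRight
  have hi : Function.Injective i :=
    Algebra.TensorProduct.includeRight_injective (IsFractionRing.injective D K)
  have key (P : D[X]) : aeval (i a) (P.map (algebraMap D K)) = i (aeval a P) := by
    rw [aeval_map_algebraMap, aeval_algHom_apply]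
  obtain ⟨f, hf, hfa⟩ := Algebra.IsIntegral.isIntegral (R := D) a
  have hfa : aeval a f = 0 := hfa
  have hint : IsIntegral K (i a) := ⟨f.map (algebraMap D K), hf.map _, by
    have := key f
    rwa [hfa, map_zero, aeval_def] at this⟩
  have hdvd : minpoly K (i a) ∣ f.map (algebraMap D K) :=
    minpoly.dvd K _ (by rw [key, hfa, map_zero])
  obtain ⟨μ, hμ⟩ := IsIntegrallyClosed.eq_map_mul_C_of_dvd K hf hdvd
  rw [(minpoly.monic hint).leadingCoeff, C_1, mul_one] at hμ
  have hmonic : μ.Monic :=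
    monic_of_injective (IsFractionRing.injective D K) (hμ ▸ minpoly.monic hint)
  refine ⟨μ, hmonic, hi ?_, fun P hP ↦ ?_⟩
  · rw [← key, hμ, minpoly.aeval, map_zero]
  · rw [← map_dvd_map _ (IsFractionRing.injective D K) hmonic, hμ]
    exact minpoly.dvd K _ (by rw [key, hP, map_zero])

lemma linearIndependent_pow {D Λ : Type*} [CommRing D] [Ring Λ] [Algebra D Λ]
    {a : Λ} {μ : D[X]} (hμ : IsMinimalPolynomial a μ) {k : ℕ} (hk : k ≤ μ.natDegree) :
    LinearIndependent D (fun i : Fin k ↦ a ^ (i : ℕ)) := by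
  nontriviality D
  rw [Fintype.linearIndependent_iff]
  intro c hc
  have h0 : (∑ i : Fin k, C (c i) * X ^ (i : ℕ) : D[X]) = 0 := by
    by_contra h0
    refine hμ.monic.not_dvd_of_degree_lt h0 ?_ (hμ.dvd_of_aeval_eq_zero _ ?_)
    · rw [degree_eq_natDegree hμ.monic.ne_zero]
      exact (degree_sum_fin_lt c).trans_le (by exact_mod_cast hk)
    · simpa [Algebra.smul_def] using hc
  intro i
  have := congrArg (coeff · (i : ℕ)) h0
  simpa [finsetSum_coeff, coeff_X_pow, Fin.val_inj] using this

end IsMinimalPolynomial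

open Polynomial in
lemma isMinimalPolynomial_of_linearIndependent {D Λ : Type*} [CommRing D] [Ring Λ] [Algebra D Λ]
    {a : Λ} {μ : D[X]} (hμ : μ.Monic) (ha : aeval a μ = 0)
    (h : LinearIndependent D (fun i : Fin μ.natDegree ↦ a ^ (i : ℕ))) :
    IsMinimalPolynomial a μ := by
  refine ⟨hμ, ha, fun P hP ↦ ?_⟩
  nontriviality D
  rw [← modByMonic_eq_zero_iff_dvd hμ]
  by_contra h0
  have hdeg : (P %ₘ μ).natDegree < μ.natDegree :=
    natDegree_lt_natDegree h0 (degree_modByMonic_lt P hμ)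
  have hr : aeval a (P %ₘ μ) = 0 := by
    have := congrArg (aeval a) (modByMonic_add_div P μ)
    simpa [ha, hP] using this
  rw [aeval_eq_sum_range' hdeg, ← Fin.sum_univ_eq_sum_range
    (fun i ↦ (P %ₘ μ).coeff i • a ^ i)] at hr
  rw [Fintype.linearIndependent_iff] at h
  exact h0 (leadingCoeff_eq_zero.mp (h (fun i ↦ (P %ₘ μ).coeff i) hr ⟨_, hdeg⟩))

open Polynomial in
lemma map_aeval_of_semilinear {D D' Λ Λ' : Type*} [CommRing D] [CommRing D'] [Ring Λ] [Ring Λ']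
    [Algebra D Λ] [Algebra D' Λ'] (i : D →+* D') (φ : Λ →+* Λ')
    (hφ : ∀ (c : D) (x : Λ), φ (c • x) = i c • φ x) (a : Λ) (P : D[X]) :
    φ (aeval a P) = aeval (φ a) (P.map i) := by
  rw [aeval_eq_sum_range, map_sum,
    aeval_eq_sum_range' (Nat.lt_succ_of_le (natDegree_map_le (f := i) (p := P)))]
  simp [hφ]

open Polynomial in
/-- An injective extension of domains keeps the minimal polynomial of an element of a free algebra,
because it keeps the linear independence of `1, a, …, a ^ (d - 1)`. -/
lemma IsMinimalPolynomial.map {D D' Λ Λ' ι : Type*} [Finite ι] [CommRing D] [CommRing D']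
    [IsDomain D'] [Ring Λ] [Ring Λ'] [Algebra D Λ] [Algebra D' Λ'] (i : D →+* D')
    (hi : Function.Injective i) (φ : Λ →+* Λ') (hφ : ∀ (c : D) (x : Λ), φ (c • x) = i c • φ x)
    (b : Module.Basis ι D Λ) (b' : Module.Basis ι D' Λ') (hb : ∀ j, φ (b j) = b' j)
    {a : Λ} {μ : D[X]} (hμ : IsMinimalPolynomial a μ) :
    IsMinimalPolynomial (φ a) (μ.map i) := by
  algebraize [i]
  have : FaithfulSMul D D' := (faithfulSMul_iff_algebraMap_injective D D').mpr hi
  have hcoord (x : Λ) : b'.equivFun (φ x) = algebraMap D D' ∘ b.equivFun x := by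
    cases nonempty_fintype ι
    apply b'.equivFun.symm.injective
    conv_lhs => rw [← b.sum_equivFun x]
    rw [LinearEquiv.symm_apply_apply, b'.equivFun_symm_apply, map_sum]
    exact Finset.sum_congr rfl fun j _ ↦ by rw [hφ, hb]; rfl
  have hpoly := map_aeval_of_semilinear i φ hφ a
  refine isMinimalPolynomial_of_linearIndependent (hμ.monic.map i)
    (by rw [← hpoly, hμ.aeval_eq_zero, map_zero]) ?_
  rw [hμ.monic.natDegree_map]
  have h1 := (hμ.linearIndependent_pow le_rfl).map' (b.equivFun : Λ →ₗ[D] ι → D)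
    b.equivFun.ker
  rw [← linearIndependent_algebraMap_comp_iff (S := D')] at h1
  refine .of_comp (b'.equivFun : Λ' →ₗ[D'] ι → D') ?_
  convert h1 using 2 with k
  exact (congrArg b'.equivFun (map_pow φ a k)).symm.trans (hcoord _)

/-- Linearly independent vectors over a field are detected by an alternating form: the determinant on
their span, composed with a projection to it. -/
lemma LinearIndependent.exists_alternatingMap_eq_one {K E : Type*} [Field K] [AddCommGroup E]
    [Module K E] {k : ℕ} {v : Fin k → E} (hv : LinearIndependent K v) :
    ∃ f : E [⋀^Fin k]→ₗ[K] K, f v = 1 := by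
  obtain ⟨p, hp⟩ := LinearMap.exists_leftInverse_of_injective _
    (Submodule.ker_subtype (Submodule.span K (Set.range v)))
  let b := Module.Basis.span hv
  refine ⟨b.det.compLinearMap p, ?_⟩
  have : (fun j ↦ p (v j)) = b := by
    ext j : 1
    have h2 : v j = (Submodule.span K (Set.range v)).subtype (b j) := by
      simp [b, Module.Basis.span_apply]
    rw [h2]
    exact LinearMap.congr_fun hp (b j)
  change b.det (fun j ↦ p (v j)) = 1
  rw [this, b.det_self]

/-- The exterior product of linearly independent vectors in a free module over a domain is not zero,
because it is not zero over the fraction field. -/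
lemma exteriorPower_ιMulti_ne_zero {D M : Type*} [CommRing D] [IsDomain D] [AddCommGroup M]
    [Module D M] [Module.Free D M] {k : ℕ} {v : Fin k → M} (hv : LinearIndependent D v) :
    exteriorPower.ιMulti D k v ≠ 0 := by
  intro h0
  let K := FractionRing D
  let i : M →ₗ[D] TensorProduct D K M := TensorProduct.mk D K M 1
  have hi : Function.Injective i := by
    have h := Module.Flat.rTensor_preserves_injective_linearMap (M := M) (Algebra.linearMap D K)
      (IsFractionRing.injective D K)
    convert h.comp (TensorProduct.lid D M).symm.injective using 1
    ext x
    simp [i]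
  have hv' : LinearIndependent K (i ∘ v) := by
    rw [← LinearIndependent.iff_fractionRing (R := D)]
    exact hv.map' i (LinearMap.ker_eq_bot.mpr hi)
  obtain ⟨f, hf⟩ := hv'.exists_alternatingMap_eq_one
  -- `f` is only alternating over `K`, so its composite with `i` is built by hand.
  let g : M [⋀^Fin k]→ₗ[D] K :=
    { toFun := fun w ↦ f (i ∘ w)
      map_update_add' := fun w j x y ↦ by
        simp [Function.comp_update]
      map_update_smul' := fun w j c x ↦ by
        rw [Function.comp_update, Function.comp_update, map_smul, ← algebraMap_smul K c (i x),
          f.map_update_smul, algebraMap_smul]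
      map_eq_zero_of_eq' := fun w j l h hjl ↦ f.map_eq_zero_of_eq _ (by simp [h]) hjl }
  have h1 : g v = 1 := hf
  have h2 := exteriorPower.alternatingMapLinearEquiv_apply_ιMulti g v
  rw [h0, map_zero, h1] at h2
  exact zero_ne_one h2

lemma exteriorPower_ιMulti_pow_eq_zero {D Λ : Type*} [CommRing D] [Ring Λ] [Algebra D Λ] {a : Λ}
    {k : ℕ} (c : Fin k → D) (h : a ^ k = ∑ i : Fin k, c i • a ^ (i : ℕ)) :
    exteriorPower.ιMulti D (k + 1) (fun i : Fin (k + 1) ↦ a ^ (i : ℕ)) = 0 := by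
  have h1 : (fun i : Fin (k + 1) ↦ a ^ (i : ℕ)) = Function.update (fun i : Fin (k + 1) ↦ a ^ (i : ℕ))
      (Fin.last k) (∑ i : Fin k, c i • a ^ (i : ℕ)) := by
    rw [← h, eq_comm]
    exact Function.update_eq_self (Fin.last k) _
  rw [h1, AlternatingMap.map_update_sum]
  refine Finset.sum_eq_zero fun i _ ↦ ?_
  rw [AlternatingMap.map_update_smul]
  refine (congrArg _ (AlternatingMap.map_eq_zero_of_eq _ _ (i := i.castSucc) (j := Fin.last k) ?_
    (Fin.castSucc_lt_last i).ne)).trans (smul_zero _)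
  simp

namespace MvPolynomial

lemma isIntegrallyClosed_fin {R : Type*} [CommRing R] [IsDomain R] [IsIntegrallyClosed R] (n : ℕ) :
    IsIntegrallyClosed (MvPolynomial (Fin n) R) := by
  induction n with
  | zero => exact .of_equiv (isEmptyRingEquiv R (Fin 0)).symm
  | succ n ih => exact .of_equiv (finSuccEquiv R n).toRingEquiv.symm

/-- A factor of a homogeneous polynomial is homogeneous, if the other factor is. -/
lemma IsHomogeneous.of_mul_right {R σ : Type*} [CommRing R] [IsDomain R] {d e : ℕ}
    {p q : MvPolynomial σ R} (hq : q.IsHomogeneous e) (hq0 : q ≠ 0)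
    (hpq : (p * q).IsHomogeneous d) : p.IsHomogeneous (d - e) := by
  have key (k : ℕ) : homogeneousComponent (k + e) (p * q) = homogeneousComponent k p * q := by
    conv_lhs => rw [← sum_homogeneousComponent p, Finset.sum_mul, map_sum]
    simp_rw [homogeneousComponent_of_mem
      ((homogeneousComponent_isHomogeneous _ p).mul hq), add_left_inj]
    rw [Finset.sum_ite_eq]
    split_ifs with h
    · rfl
    · rw [homogeneousComponent_eq_zero _ _ (by simpa using h), zero_mul]
  have h0 (k : ℕ) (hk : k + e ≠ d) : homogeneousComponent k p = 0 := by
    have := key k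
    rw [homogeneousComponent_of_mem hpq, if_neg hk] at this
    exact (mul_eq_zero.mp this.symm).resolve_right hq0
  rw [← sum_homogeneousComponent p]
  refine IsHomogeneous.sum _ _ _ fun k _ ↦ ?_
  by_cases hk : k + e = d
  · rw [← hk, Nat.add_sub_cancel]
    exact homogeneousComponent_isHomogeneous k p
  · rw [h0 k hk]
    exact isHomogeneous_zero _ _ _

lemma _root_.Polynomial.natDegree_prod_le_and_coeff_prod {D σ : Type*} [CommRing D] (s : Finset σ)
    (f : σ → Polynomial D) (n : σ → ℕ) (h : ∀ i, (f i).natDegree ≤ n i) :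
    (∏ i ∈ s, f i).natDegree ≤ ∑ i ∈ s, n i ∧
    (∏ i ∈ s, f i).coeff (∑ i ∈ s, n i) = ∏ i ∈ s, (f i).coeff (n i) := by
  classical
  induction s using Finset.induction_on with
  | empty => simp
  | insert i s hi ih =>
    simp only [Finset.prod_insert hi, Finset.sum_insert hi]
    exact ⟨Polynomial.natDegree_mul_le_of_le (h i) ih.1,
      by rw [Polynomial.coeff_mul_add_eq_of_natDegree_le (h i) ih.1, ih.2]⟩

/-- Substituting `u X - a` in a homogeneous polynomial of degree `d` gives a polynomial in `X` of
degree at most `d`, whose coefficient of `X ^ d` is the value at `u`. -/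
lemma IsHomogeneous.eval₂_linear {R D σ : Type*} [CommRing R] [CommRing D] (φ : R →+* D) {d : ℕ}
    {p : MvPolynomial σ R} (hp : p.IsHomogeneous d) (u a : σ → D) :
    (p.eval₂ (Polynomial.C.comp φ) fun i ↦ .C (u i) * .X - .C (a i)).natDegree ≤ d ∧
    (p.eval₂ (Polynomial.C.comp φ) fun i ↦ .C (u i) * .X - .C (a i)).coeff d = p.eval₂ φ u := by
  set l : σ → Polynomial D := fun i ↦ .C (u i) * .X - .C (a i)
  have hl (i : σ) (k : ℕ) : (l i ^ k).natDegree ≤ k ∧ (l i ^ k).coeff k = u i ^ k := by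
    have h1 : (l i).natDegree ≤ 1 := by
      rw [show l i = .C (u i) * .X + .C (- a i) by simp [l, sub_eq_add_neg]]
      exact Polynomial.natDegree_linear_le
    refine ⟨by simpa using Polynomial.natDegree_pow_le_of_le k h1, ?_⟩
    simpa [l, Polynomial.coeff_C] using Polynomial.coeff_pow_of_natDegree_le (m := k) h1
  have hm (m : σ →₀ ℕ) (hmp : m ∈ p.support) :
      (∏ i ∈ m.support, l i ^ m i).natDegree ≤ d ∧
      (∏ i ∈ m.support, l i ^ m i).coeff d = ∏ i ∈ m.support, u i ^ m i := by
    have := Polynomial.natDegree_prod_le_and_coeff_prod m.support (fun i ↦ l i ^ m i) m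
      (fun i ↦ (hl i _).1)
    rw [← hp.degree_eq_sum_deg_support hmp] at this
    exact ⟨this.1, this.2.trans (Finset.prod_congr rfl fun i _ ↦ (hl i _).2)⟩
  rw [eval₂_eq, eval₂_eq]
  constructor
  · refine Polynomial.natDegree_sum_le_of_forall_le _ _ fun m hmp ↦ ?_
    exact (Polynomial.natDegree_C_mul_le _ _).trans (hm m hmp).1
  · rw [Polynomial.finsetSum_coeff]
    refine Finset.sum_congr rfl fun m hmp ↦ ?_
    rw [RingHom.comp_apply, Polynomial.coeff_C_mul, (hm m hmp).2]

end MvPolynomial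

/-! ### Restriction to opens of the base, gluing of functions, and frames -/

namespace AlgebraScheme

variable {S : Scheme.{u}}

/-- The pullback of functions along a morphism of `S`-schemes. -/
abbrev pullbackFun {T' T : Over S} (g : T' ⟶ T) : Γ(T.left, ⊤) →+* Γ(T'.left, ⊤) :=
  g.left.appTop.hom

lemma pullbackFun_comp {T'' T' T : Over S} (h : T'' ⟶ T') (g : T' ⟶ T) :
    pullbackFun (h ≫ g) = (pullbackFun h).comp (pullbackFun g) := by
  ext x
  simp [pullbackFun, -TopologicalSpace.Opens.map_top]
  rfl

lemma pullbackFun_comp_apply {T'' T' T : Over S} (h : T'' ⟶ T') (g : T' ⟶ T) (x : Γ(T.left, ⊤)) :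
    pullbackFun (h ≫ g) x = pullbackFun h (pullbackFun g x) := by
  rw [pullbackFun_comp, RingHom.comp_apply]

lemma pullbackFun_id (T : Over S) : pullbackFun (𝟙 T) = RingHom.id _ := by
  ext x
  simp [pullbackFun]

/-- The restriction of an `S`-scheme `T` to an open `U` of `S`. -/
def restrictTo (T : Over S) (U : S.Opens) : Over S :=
  Over.mk ((T.hom ⁻¹ᵁ U).ι ≫ T.hom)

/-- The inclusion of the restriction of `T` to `U` in `T`. -/
def restrictι (T : Over S) (U : S.Opens) : restrictTo T U ⟶ T :=
  Over.homMk (T.hom ⁻¹ᵁ U).ι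

/-- The structure morphism to `U` of the restriction of `T` to `U`. -/
def restrictπ (T : Over S) (U : S.Opens) : restrictTo T U ⟶ Over.mk U.ι :=
  Over.homMk (T.hom ∣_ U) (morphismRestrict_ι T.hom U)

instance (T : Over S) (U : S.Opens) : IsOpenImmersion (restrictι T U).left :=
  inferInstanceAs (IsOpenImmersion (T.hom ⁻¹ᵁ U).ι)

instance (T : Over S) (U : S.Opens) : Mono (restrictι T U) :=
  (Over.forget S).mono_of_mono_map (inferInstanceAs (Mono (restrictι T U).left))

instance (U : S.Opens) (T : Over S) : Subsingleton (T ⟶ Over.mk U.ι) where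
  allEq g h := by
    ext1
    rw [← cancel_mono U.ι]
    exact (Over.w g).trans (Over.w h).symm

lemma range_restrictι (T : Over S) (U : S.Opens) :
    Set.range (restrictι T U).left = T.hom ⁻¹' U :=
  (T.hom ⁻¹ᵁ U).range_ι

lemma range_subset_range_restrictι {W T : Over S} {U : S.Opens} (g : W ⟶ T)
    (h : W ⟶ Over.mk U.ι) : Set.range g.left ⊆ Set.range (restrictι T U).left := by
  rw [range_restrictι]
  intro x hx
  obtain ⟨w, rfl⟩ := hx
  have h1 : W.hom w = U.ι (h.left w) := by
    rw [← Over.w h]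
    rfl
  have h2 : T.hom (g.left w) = W.hom w := by
    rw [← Over.w g]
    rfl
  change T.hom (g.left w) ∈ U
  rw [h2, h1]
  exact (h.left w).2

/-- A morphism from an `S`-scheme over `U` to `T` factors through the restriction of `T` to `U`. -/
def restrictLift {W T : Over S} {U : S.Opens} (g : W ⟶ T) (h : W ⟶ Over.mk U.ι) :
    W ⟶ restrictTo T U :=
  Over.homMk (IsOpenImmersion.lift (restrictι T U).left g.left
    (range_subset_range_restrictι g h)) (by
    have h1 := IsOpenImmersion.lift_fac (restrictι T U).left g.left
      (range_subset_range_restrictι g h)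
    rw [← Over.w (restrictι T U), ← Category.assoc, h1, Over.w])

@[simp]
lemma restrictLift_ι {W T : Over S} {U : S.Opens} (g : W ⟶ T) (h : W ⟶ Over.mk U.ι) :
    restrictLift g h ≫ restrictι T U = g := by
  ext1
  exact IsOpenImmersion.lift_fac _ _ _

/-- The restriction to `U` of a morphism of `S`-schemes. -/
def restrictMap {W T : Over S} (g : W ⟶ T) (U : S.Opens) : restrictTo W U ⟶ restrictTo T U :=
  restrictLift (restrictι W U ≫ g) (restrictπ W U)

lemma restrictMap_ι {W T : Over S} (g : W ⟶ T) (U : S.Opens) :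
    restrictMap g U ≫ restrictι T U = restrictι W U ≫ g :=
  restrictLift_ι _ _

lemma isOpenCover_preimage (T : Over S) {U : S → S.Opens} (hU : ∀ s, s ∈ U s) :
    TopologicalSpace.IsOpenCover fun s ↦ T.hom ⁻¹ᵁ U s :=
  top_le_iff.mp fun t _ ↦ TopologicalSpace.Opens.mem_iSup.mpr ⟨T.hom t, hU _⟩

/-- Morphisms of `S`-schemes are determined locally on `S`. -/
lemma hom_ext_of_restrict {T X : Over S} {a b : T ⟶ X}
    (h : ∀ s : S, ∃ U : S.Opens, s ∈ U ∧ restrictι T U ≫ a = restrictι T U ≫ b) : a = b := by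
  choose U hU hab using h
  ext1
  exact Scheme.Cover.hom_ext (T.left.openCoverOfIsOpenCover _ (isOpenCover_preimage T hU)) _ _
    fun s ↦ congrArg CommaMorphism.left (hab s)

/-- Functions on an `S`-scheme are determined locally on `S`. -/
lemma fun_ext_of_restrict {T : Over S} {x y : Γ(T.left, ⊤)}
    (h : ∀ s : S, ∃ U : S.Opens, s ∈ U ∧
      pullbackFun (restrictι T U) x = pullbackFun (restrictι T U) y) : x = y := by
  choose U hU hxy using h
  exact Scheme.OpenCover.ext_elem x y
    (T.left.openCoverOfIsOpenCover _ (isOpenCover_preimage T hU)) hxy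

/-- An open subscheme of `S` contained in `U`, as a scheme over `U`. -/
def opensHom {U' U : S.Opens} (h : U' ≤ U) : Over.mk U'.ι ⟶ Over.mk U.ι :=
  Over.homMk (S.homOfLE h)

/-- The inclusion of the restriction of `T` to `U'` in the restriction to `U`, for `U' ≤ U`. -/
def restrictOfLE (T : Over S) {U' U : S.Opens} (h : U' ≤ U) : restrictTo T U' ⟶ restrictTo T U :=
  Over.homMk (T.left.homOfLE (T.hom.preimage_mono h)) (by
    change T.left.homOfLE _ ≫ (T.hom ⁻¹ᵁ U).ι ≫ T.hom = (T.hom ⁻¹ᵁ U').ι ≫ T.hom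
    rw [← Category.assoc, T.left.homOfLE_ι (T.hom.preimage_mono h)])

/-- Gluing of functions on `T` along an open cover of `S`. -/
lemma exists_fun_of_restrict {T : Over S} {U : S → S.Opens} (hU : ∀ s, s ∈ U s)
    (x : ∀ s, Γ((restrictTo T (U s)).left, ⊤))
    (hx : ∀ s t, pullbackFun (restrictOfLE T (inf_le_left : U s ⊓ U t ≤ U s)) (x s) =
      pullbackFun (restrictOfLE T (inf_le_right : U s ⊓ U t ≤ U t)) (x t)) :
    ∃ y : Γ(T.left, ⊤), ∀ s, pullbackFun (restrictι T (U s)) y = x s := by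
  let V (s : S) : T.left.Opens := T.hom ⁻¹ᵁ U s
  let W (s : S) : T.left.Opens := (V s).ι ''ᵁ ⊤
  have hW (s : S) : W s = V s := (V s).ι_image_top
  obtain ⟨y, hy, -⟩ := T.left.sheaf.existsUnique_gluing' W ⊤ (fun s ↦ homOfLE le_top)
    (by rw [funext hW]; exact (isOpenCover_preimage T hU).ge) x fun s t ↦ by
      have hle : W s ⊓ W t ≤ (V s ⊓ V t).ι ''ᵁ ⊤ := by
        rw [hW, hW, (V s ⊓ V t).ι_image_top]
      have h1 := congrArg (T.left.presheaf.map (homOfLE hle).op) (hx s t)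
      have h2 (r : S) (hr : V s ⊓ V t ≤ V r) (z : Γ((restrictTo T (U r)).left, ⊤)) :
          T.left.presheaf.map (homOfLE hle).op ((T.left.homOfLE hr).appTop z) =
            T.left.presheaf.map (homOfLE (hle.trans ((V s ⊓ V t).ι_image_top.trans_le
              (hr.trans (hW r).ge)))).op z := by
        rw [Scheme.homOfLE_appTop]
        exact (ConcreteCategory.comp_apply _ _ _).symm.trans
          (ConcreteCategory.congr_hom (T.left.presheaf.map_comp _ _).symm z)
      exact (h2 s inf_le_left _).symm.trans (h1.trans (h2 t inf_le_right _))
  exact ⟨y, hy⟩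

variable (A : AlgebraScheme S)

/-- Precomposition with `g : T' ⟶ T`, as a ring homomorphism from `A(T)` to `A(T')`. -/
def precomp {T' T : Over S} (g : T' ⟶ T) : (T ⟶ A.X) →+* (T' ⟶ A.X) :=
  RingHom.mk' ⟨⟨fun a ↦ g ≫ a, A.comp_one g⟩, A.comp_mul g⟩ (A.comp_add g)

@[simp]
lemma precomp_apply {T' T : Over S} (g : T' ⟶ T) (a : T ⟶ A.X) : A.precomp g a = g ≫ a := rfl

lemma precomp_smul {T' T : Over S} (g : T' ⟶ T) (c : Γ(T.left, ⊤)) (a : T ⟶ A.X) :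
    A.precomp g (c • a) = pullbackFun g c • A.precomp g a :=
  A.comp_smul g c a

lemma comp_sum {T' T : Over S} (g : T' ⟶ T) {ι : Type*} (s : Finset ι) (a : ι → (T ⟶ A.X)) :
    g ≫ (∑ i ∈ s, a i) = ∑ i ∈ s, g ≫ a i :=
  map_sum (A.precomp g) a s

lemma comp_sub {T' T : Over S} (g : T' ⟶ T) (a b : T ⟶ A.X) : g ≫ (a - b) = g ≫ a - g ≫ b :=
  map_sub (A.precomp g) a b

lemma comp_aeval {T' T : Over S} (g : T' ⟶ T) (a : T ⟶ A.X) (P : Polynomial Γ(T.left, ⊤)) :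
    g ≫ Polynomial.aeval a P = Polynomial.aeval (g ≫ a) (P.map (pullbackFun g)) :=
  map_aeval_of_semilinear (pullbackFun g) (A.precomp g) (A.precomp_smul g) a P

variable {A}

lemma value_comp (δ : Γ(A.X.left, ⊤)) {T' T : Over S} (g : T' ⟶ T) (a : T ⟶ A.X) :
    value δ (g ≫ a) = pullbackFun g (value δ a) :=
  pullbackFun_comp_apply g a δ

lemma value_id (δ : Γ(A.X.left, ⊤)) : value δ (𝟙 A.X) = δ := by
  change pullbackFun (𝟙 A.X) δ = δ
  rw [pullbackFun_id, RingHom.id_apply]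

lemma value_mul (δ ε : Γ(A.X.left, ⊤)) {T : Over S} (a : T ⟶ A.X) :
    value (δ * ε) a = value δ a * value ε a :=
  map_mul _ _ _

lemma value_pullback {B : AlgebraScheme S} (f : Hom A B) (δ : Γ(B.X.left, ⊤)) {T : Over S}
    (a : T ⟶ A.X) : value (f.pullback δ) a = value δ (a ≫ f.hom) :=
  (pullbackFun_comp_apply a f.hom δ).symm

/-- The algebra homomorphism on `T`-points given by a homomorphism of algebra schemes. -/
def Hom.onPoints {B : AlgebraScheme S} (f : Hom A B) (T : Over S) :
    (T ⟶ A.X) →ₐ[Γ(T.left, ⊤)] (T ⟶ B.X) :=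
  AlgHom.ofLinearMap ⟨⟨fun a ↦ a ≫ f.hom, f.map_add⟩, f.map_smul⟩ f.map_one f.map_mul

lemma Hom.aeval_comp {B : AlgebraScheme S} (f : Hom A B) {T : Over S} (a : T ⟶ A.X)
    (P : Polynomial Γ(T.left, ⊤)) :
    Polynomial.aeval a P ≫ f.hom = Polynomial.aeval (a ≫ f.hom) P :=
  (Polynomial.aeval_algHom_apply (f.onPoints T) a P).symm

namespace IsFrame

variable {V : Over S} {n : ℕ} {e : Fin n → (V ⟶ A.X)}

lemma precomp (he : A.IsFrame e) {V' : Over S} (h : V' ⟶ V) : A.IsFrame fun i ↦ h ≫ e i := by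
  intro T g
  simpa using he (g ≫ h)

/-- The basis of `A(T)` given by a frame. -/
def basis (he : A.IsFrame e) {T : Over S} (g : T ⟶ V) :
    Module.Basis (Fin n) Γ(T.left, ⊤) (T ⟶ A.X) :=
  Module.Basis.mk (he g).1 (he g).2.ge

@[simp]
lemma basis_apply (he : A.IsFrame e) {T : Over S} (g : T ⟶ V) (i : Fin n) :
    he.basis g i = g ≫ e i := by
  simp [basis]

lemma sum_coord (he : A.IsFrame e) {T : Over S} (g : T ⟶ V) (a : T ⟶ A.X) :
    ∑ i, (he.basis g).equivFun a i • (g ≫ e i) = a := by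
  simpa using (he.basis g).sum_equivFun a

lemma coord_sum (he : A.IsFrame e) {T : Over S} (g : T ⟶ V) (c : Fin n → Γ(T.left, ⊤)) :
    (he.basis g).equivFun (∑ i, c i • (g ≫ e i)) = c := by
  have h := (he.basis g).equivFun.apply_symm_apply c
  rw [(he.basis g).equivFun_symm_apply] at h
  simpa only [basis_apply] using h

lemma coord_comp (he : A.IsFrame e) {T' T : Over S} (h : T' ⟶ T) (g : T ⟶ V) (a : T ⟶ A.X)
    (i : Fin n) :
    (he.basis (h ≫ g)).equivFun (h ≫ a) i = pullbackFun h ((he.basis g).equivFun a i) := by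
  conv_lhs => rw [← he.sum_coord g a, A.comp_sum]
  simp_rw [A.comp_smul, ← Category.assoc]
  rw [he.coord_sum]

end IsFrame

lemma IsOfDim.exists_isAffineOpen {n : ℕ} (hA : A.IsOfDim n) (s : S) :
    ∃ U : S.Opens, s ∈ U ∧ IsAffineOpen U ∧ ∃ e : Fin n → (Over.mk U.ι ⟶ A.X), A.IsFrame e := by
  obtain ⟨U, hs, e, he⟩ := hA s
  obtain ⟨_, ⟨U', hU', rfl⟩, hs', hU'U : U' ≤ U⟩ :=
    S.isBasis_affineOpens.exists_subset_of_mem_open hs U.isOpen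
  exact ⟨U', hs', hU', _, he.precomp (opensHom hU'U)⟩

end AlgebraScheme

/-! ### Affine spaces and the total space of an algebra scheme -/

namespace AlgebraScheme

variable {S : Scheme.{u}} {A : AlgebraScheme S}

/-- Affine `n`-space over an `S`-scheme `V`, as an `S`-scheme. -/
def affineSpaceOver (n : ℕ) (V : Over S) : Over S :=
  Over.mk ((𝔸(ULift.{u} (Fin n); V.left) ↘ V.left) ≫ V.hom)

/-- The projection from affine space over `V` to `V`. -/
def affineSpaceProj (n : ℕ) (V : Over S) : affineSpaceOver n V ⟶ V :=
  Over.homMk (𝔸(ULift.{u} (Fin n); V.left) ↘ V.left)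

/-- The coordinates of affine space over `V`. -/
def affineSpaceCoord (n : ℕ) (V : Over S) (i : Fin n) : Γ((affineSpaceOver n V).left, ⊤) :=
  AffineSpace.coord V.left (ULift.up i)

/-- The morphism to affine space over `V` with given coordinates. -/
def affineSpaceLift {n : ℕ} {T V : Over S} (g : T ⟶ V) (c : Fin n → Γ(T.left, ⊤)) :
    T ⟶ affineSpaceOver n V :=
  Over.homMk (AffineSpace.homOfVector g.left fun i ↦ c i.down) (by
    rw [← Over.w g]
    exact AffineSpace.homOfVector_over_assoc _ _ _)

lemma affineSpaceLift_proj {n : ℕ} {T V : Over S} (g : T ⟶ V) (c : Fin n → Γ(T.left, ⊤)) :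
    affineSpaceLift g c ≫ affineSpaceProj n V = g := by
  ext1
  exact AffineSpace.homOfVector_over _ _

lemma pullbackFun_affineSpaceLift {n : ℕ} {T V : Over S} (g : T ⟶ V) (c : Fin n → Γ(T.left, ⊤))
    (i : Fin n) : pullbackFun (affineSpaceLift g c) (affineSpaceCoord n V i) = c i :=
  AffineSpace.homOfVector_appTop_coord _ _ _

lemma affineSpace_hom_ext {n : ℕ} {T V : Over S} {f g : T ⟶ affineSpaceOver n V}
    (h : f ≫ affineSpaceProj n V = g ≫ affineSpaceProj n V)
    (hc : ∀ i, pullbackFun f (affineSpaceCoord n V i) = pullbackFun g (affineSpaceCoord n V i)) :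
    f = g := by
  ext1
  exact AffineSpace.hom_ext (congrArg CommaMorphism.left h) fun i ↦ hc i.down

lemma bijective_eval₂Hom_affineSpace (σ : Type u) (V : Scheme.{u}) [IsAffine V] :
    Function.Bijective (MvPolynomial.eval₂Hom (𝔸(σ; V) ↘ V).appTop.hom (AffineSpace.coord V)) := by
  have h := AffineSpace.isoOfIsAffine_hom_appTop (n := σ) (S := V)
  rw [← Iso.inv_comp_eq] at h
  have : IsIso (AffineSpace.isoOfIsAffine σ V).hom.appTop :=
    inferInstanceAs (IsIso (Scheme.Γ.map (AffineSpace.isoOfIsAffine σ V).hom.op))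
  have h2 := ConcreteCategory.bijective_of_isIso
    ((Scheme.ΓSpecIso (.of (MvPolynomial σ Γ(V, ⊤)))).inv ≫
      (AffineSpace.isoOfIsAffine σ V).hom.appTop)
  rw [h] at h2
  exact h2

/-- Over an affine base, the functions on affine space are the polynomials in the coordinates. -/
lemma bijective_eval₂_affineSpaceCoord (n : ℕ) (V : Over S) [IsAffine V.left] :
    Function.Bijective fun p : MvPolynomial (Fin n) Γ(V.left, ⊤) ↦
      p.eval₂ (pullbackFun (affineSpaceProj n V)) (affineSpaceCoord n V) := by
  have h := (bijective_eval₂Hom_affineSpace (ULift.{u} (Fin n)) V.left).comp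
    (MvPolynomial.renameEquiv Γ(V.left, ⊤) Equiv.ulift.symm).bijective
  refine (congrArg Function.Bijective (funext fun p ↦ ?_)).mp h
  exact MvPolynomial.eval₂_rename _ _ _ p

/-- Over the affine line on an affine scheme, distinct polynomials are distinct functions. -/
lemma injective_eval₂_lineCoord (T : Over S) [IsAffine T.left] :
    Function.Injective fun P : Polynomial Γ(T.left, ⊤) ↦
      P.eval₂ (pullbackFun (lineProj T)) (lineCoord T) := by
  have h := (bijective_eval₂Hom_affineSpace PUnit.{u + 1} T.left).1.comp
    (MvPolynomial.uniqueAlgEquiv Γ(T.left, ⊤) PUnit.{u + 1}).symm.injective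
  refine (congrArg Function.Injective (funext fun P ↦ ?_)).mp h
  exact MvPolynomial.eval₂_uniqueAlgEquiv_symm

/-- The morphism to the affine line over `T` with given coordinate. -/
def lineLift {T' T : Over S} (g : T' ⟶ T) (x : Γ(T'.left, ⊤)) : T' ⟶ line T :=
  Over.homMk (AffineSpace.homOfVector g.left fun _ ↦ x) (by
    rw [← Over.w g]
    exact AffineSpace.homOfVector_over_assoc _ _ _)

lemma lineLift_proj {T' T : Over S} (g : T' ⟶ T) (x : Γ(T'.left, ⊤)) :
    lineLift g x ≫ lineProj T = g := by
  ext1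
  exact AffineSpace.homOfVector_over _ _

lemma pullbackFun_lineLift {T' T : Over S} (g : T' ⟶ T) (x : Γ(T'.left, ⊤)) :
    pullbackFun (lineLift g x) (lineCoord T) = x :=
  AffineSpace.homOfVector_appTop_coord _ _ _

namespace IsFrame

variable {U : S.Opens} {n : ℕ} {e : Fin n → (Over.mk U.ι ⟶ A.X)}

/-- The coordinates, in a frame over `U`, of the universal point of the restriction of `A`. -/
def coords (he : A.IsFrame e) (i : Fin n) : Γ((restrictTo A.X U).left, ⊤) :=
  (he.basis (restrictπ A.X U)).equivFun (restrictι A.X U) i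

/-- The isomorphism from affine space over `U` to the restriction of `A` given by a frame. -/
def affineSpaceIso (he : A.IsFrame e) : affineSpaceOver n (Over.mk U.ι) ≅ restrictTo A.X U where
  hom := restrictLift
    (∑ i, affineSpaceCoord n (Over.mk U.ι) i • (affineSpaceProj n (Over.mk U.ι) ≫ e i))
    (affineSpaceProj n (Over.mk U.ι))
  inv := affineSpaceLift (restrictπ A.X U) he.coords
  hom_inv_id := by
    refine affineSpace_hom_ext (Subsingleton.elim _ _) fun i ↦ ?_
    rw [pullbackFun_comp_apply, pullbackFun_affineSpaceLift, coords, ← he.coord_comp,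
      Subsingleton.elim (_ ≫ restrictπ A.X U) (affineSpaceProj n (Over.mk U.ι)), restrictLift_ι,
      he.coord_sum, pullbackFun_id, RingHom.id_apply]
  inv_hom_id := by
    rw [← cancel_mono (restrictι A.X U), Category.assoc, restrictLift_ι, A.comp_sum,
      Category.id_comp]
    simp_rw [A.comp_smul, ← Category.assoc, affineSpaceLift_proj]
    conv_rhs => rw [← he.sum_coord (restrictπ A.X U) (restrictι A.X U)]
    refine Finset.sum_congr rfl fun i _ ↦ ?_
    congr 1
    exact pullbackFun_affineSpaceLift _ _ _

/-- The coordinates at the point `∑ cᵢ eᵢ` are the `cᵢ`. -/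
lemma coords_lift (he : A.IsFrame e) {T : Over S} (g : T ⟶ Over.mk U.ι)
    (c : Fin n → Γ(T.left, ⊤)) (i : Fin n) :
    pullbackFun (restrictLift (∑ i, c i • (g ≫ e i)) g) (he.coords i) = c i := by
  rw [coords, ← he.coord_comp, restrictLift_ι, Subsingleton.elim (_ ≫ restrictπ A.X U) g,
    he.coord_sum]

/-- The functions on the restriction of `A` to an affine open with a frame are the polynomials in
the coordinates. -/
lemma bijective_eval₂_coords (he : A.IsFrame e) (hU : IsAffineOpen U) :
    Function.Bijective fun p : MvPolynomial (Fin n) Γ((U : Scheme.{u}), ⊤) ↦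
      p.eval₂ (pullbackFun (restrictπ A.X U)) he.coords := by
  have : IsAffine (Over.mk U.ι).left := hU
  have : IsIso he.affineSpaceIso.inv.left.appTop :=
    inferInstanceAs (IsIso ((Over.forget S ⋙ Scheme.Γ.rightOp).map he.affineSpaceIso.inv).unop)
  have h : Function.Bijective (pullbackFun he.affineSpaceIso.inv) :=
    ConcreteCategory.bijective_of_isIso he.affineSpaceIso.inv.left.appTop
  refine (congrArg Function.Bijective (funext fun p ↦ ?_)).mp
    (h.comp (bijective_eval₂_affineSpaceCoord n (Over.mk U.ι)))
  rw [Function.comp_apply, MvPolynomial.eval₂_comp_left, ← pullbackFun_comp]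
  congr 1
  · rw [Subsingleton.elim (restrictπ A.X U)]
  · ext i
    exact pullbackFun_affineSpaceLift _ _ _

lemma isAffine_restrictTo (he : A.IsFrame e) (hU : IsAffineOpen U) :
    IsAffine (restrictTo A.X U).left := by
  have : IsAffine (U : Scheme.{u}) := hU
  have : IsAffine (affineSpaceOver n (Over.mk U.ι)).left :=
    inferInstanceAs (IsAffine 𝔸(ULift.{u} (Fin n); U))
  let i : (affineSpaceOver n (Over.mk U.ι)).left ≅ (restrictTo A.X U).left :=
    (Over.forget S).mapIso he.affineSpaceIso
  exact .of_isIso i.inv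

lemma isIntegral_restrictTo [IsIntegral S] (he : A.IsFrame e) (hU : (U : Set S).Nonempty) :
    IsIntegral (restrictTo A.X U).left := by
  have : Nonempty U := hU.to_subtype
  have : IsIntegral (U : Scheme.{u}) := isIntegral_of_isOpenImmersion U.ι
  have : IsIntegral (affineSpaceOver n (Over.mk U.ι)).left :=
    inferInstanceAs (IsIntegral 𝔸(ULift.{u} (Fin n); U))
  let i : (affineSpaceOver n (Over.mk U.ι)).left ≅ (restrictTo A.X U).left :=
    (Over.forget S).mapIso he.affineSpaceIso
  exact .of_isIso i.hom

end IsFrame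

/-- The functions on an affine open of a normal integral scheme form an integrally closed domain,
because the local rings are integrally closed. -/
lemma isIntegrallyClosed_of_isAffineOpen [IsIntegral S] [IsNormalScheme S] {U : S.Opens}
    (hU : IsAffineOpen U) (hU0 : (U : Set S).Nonempty) :
    IsIntegrallyClosed Γ((U : Scheme.{u}), ⊤) := by
  have : Nonempty U := hU0.to_subtype
  have : IsIntegrallyClosed Γ(S, U) := by
    refine .of_localization_maximal fun p _ _ ↦ ?_
    let y : PrimeSpectrum Γ(S, U) := ⟨p, inferInstance⟩
    have hy : hU.fromSpec y ∈ U := (hU.isoSpec.inv y).2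
    let := TopCat.Presheaf.algebra_section_stalk S.presheaf ⟨hU.fromSpec y, hy⟩
    have : IsLocalization p.primeCompl (S.presheaf.stalk (hU.fromSpec y)) :=
      hU.isLocalization_stalk' y hy
    have := IsNormalScheme.isIntegrallyClosed_stalk (hU.fromSpec y)
    exact .of_equiv (IsLocalization.algEquiv p.primeCompl (S.presheaf.stalk (hU.fromSpec y))
      (Localization.AtPrime p)).toRingEquiv
  exact .of_equiv U.topIso.symm.commRingCatIsoToRingEquiv

lemma IsFrame.isIntegrallyClosed_restrictTo [IsIntegral S] [IsNormalScheme S] {U : S.Opens} {n : ℕ}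
    {e : Fin n → (Over.mk U.ι ⟶ A.X)} (he : A.IsFrame e) (hU : IsAffineOpen U)
    (hU0 : (U : Set S).Nonempty) : IsIntegrallyClosed Γ((restrictTo A.X U).left, ⊤) := by
  have : Nonempty U := hU0.to_subtype
  have : IsIntegral (U : Scheme.{u}) := isIntegral_of_isOpenImmersion U.ι
  have := isIntegrallyClosed_of_isAffineOpen hU hU0
  have := MvPolynomial.isIntegrallyClosed_fin (R := Γ((U : Scheme.{u}), ⊤)) n
  exact .of_equiv (RingEquiv.ofBijective
    (MvPolynomial.eval₂Hom (pullbackFun (restrictπ A.X U)) he.coords)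
    (he.bijective_eval₂_coords hU))

variable (A) in
/-- The zero section shows that the structure morphism of an algebra scheme is surjective. -/
lemma surjective_hom : Function.Surjective A.X.hom := fun s ↦
  ⟨(0 : Over.mk (𝟙 S) ⟶ A.X).left s, by
    have := Over.w (0 : Over.mk (𝟙 S) ⟶ A.X)
    exact congr($this s)⟩

/-- The total space of a vector bundle on an integral scheme is integral. -/
lemma IsOfDim.isIntegral [IsIntegral S] {n : ℕ} (hA : A.IsOfDim n) : IsIntegral A.X.left := by
  choose U hU e he using hA
  have hcover := isOpenCover_preimage A.X hU
  have hint (s : S) : IsIntegral (restrictTo A.X (U s)).left :=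
    (he s).isIntegral_restrictTo ⟨s, hU s⟩
  have : Nonempty A.X.left := (A.surjective_hom (Classical.arbitrary S)).nonempty
  have : PreirreducibleSpace A.X.left := by
    refine .of_isOpenCover (fun s t _ ↦ ?_) hcover fun s ↦ ?_
    · obtain ⟨r, hrs, hrt⟩ := nonempty_preirreducible_inter (U s).isOpen (U t).isOpen
        ⟨s, hU s⟩ ⟨t, hU t⟩
      obtain ⟨x, rfl⟩ := A.surjective_hom r
      exact fun h ↦ (h.le_bot ⟨hrs, hrt⟩ : x ∈ (⊥ : A.X.left.Opens))
    · have := hint s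
      exact inferInstanceAs (PreirreducibleSpace (restrictTo A.X (U s)).left)
  have : IrreducibleSpace A.X.left := ⟨inferInstance⟩
  have : IsReduced A.X.left :=
    have (s : S) : IsReduced (restrictTo A.X (U s)).left :=
      have := hint s
      inferInstance
    have : ∀ s, IsReduced ((A.X.left.openCoverOfIsOpenCover _ hcover).X s) := this
    IsReduced.of_openCover _ (A.X.left.openCoverOfIsOpenCover _ hcover)
  exact isIntegral_of_irreducibleSpace_of_isReduced _

end AlgebraScheme

/-! ### The generic minimal polynomial -/

namespace AlgebraScheme

variable {S : Scheme.{u}} {A : AlgebraScheme S}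

open Polynomial

lemma pullbackFun_injective {T' T : Over S} (g : T' ⟶ T) [IsIntegral T.left] [IsDominant g.left] :
    Function.Injective (pullbackFun g) := by
  rw [injective_iff_map_eq_zero]
  intro x hx
  by_contra h0
  rw [← basicOpen_eq_bot_iff, ← ne_eq, TopologicalSpace.Opens.ne_bot_iff_nonempty] at h0
  obtain ⟨t, ht⟩ := g.left.denseRange.exists_mem_open (T.left.basicOpen x).isOpen h0
  have h1 : t ∈ g.left ⁻¹ᵁ T.left.basicOpen x := ht
  rw [Scheme.preimage_basicOpen_top] at h1
  change t ∈ T'.left.basicOpen (pullbackFun g x) at h1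
  rw [hx, Scheme.basicOpen_zero] at h1
  exact h1

lemma isDominant_of_isOpenImmersion {X Y : Scheme.{u}} (f : X ⟶ Y) [IsOpenImmersion f] [Nonempty X]
    [IrreducibleSpace Y] : IsDominant f :=
  ⟨f.isOpenEmbedding.isOpen_range.dense (Set.range_nonempty f)⟩

instance (T : Over S) (U : S.Opens) [IsIntegral T.left] [Nonempty (restrictTo T U).left] :
    IsDominant (restrictι T U).left :=
  isDominant_of_isOpenImmersion _

lemma isIntegral_restrictTo (T : Over S) (U : S.Opens) [IsIntegral T.left]
    [Nonempty (restrictTo T U).left] : IsIntegral (restrictTo T U).left :=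
  isIntegral_of_isOpenImmersion (restrictι T U).left

lemma isDominant_of_comp_restrictι {W T : Over S} {U : S.Opens} (g : W ⟶ restrictTo T U)
    [h : IsDominant (g ≫ restrictι T U).left] : IsDominant g.left :=
  have : IsDominant (g.left ≫ (restrictι T U).left) := h
  .of_comp_of_isOpenImmersion g.left (restrictι T U).left

variable (A) in
lemma nonempty_restrictTo {U : S.Opens} (hU : (U : Set S).Nonempty) :
    Nonempty (restrictTo A.X U).left := by
  obtain ⟨s, hs⟩ := hU
  obtain ⟨x, rfl⟩ := A.surjective_hom s
  exact ⟨⟨x, hs⟩⟩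

lemma IsFrame.exists_isMinimalPolynomial [IsIntegral S] [IsNormalScheme S] {U : S.Opens} {n : ℕ}
    {e : Fin n → (Over.mk U.ι ⟶ A.X)} (he : A.IsFrame e) (hU : IsAffineOpen U)
    (hU0 : (U : Set S).Nonempty) :
    ∃ μ : Γ((restrictTo A.X U).left, ⊤)[X], IsMinimalPolynomial (restrictι A.X U) μ := by
  have := he.isIntegral_restrictTo hU0
  have := he.isIntegrallyClosed_restrictTo hU hU0
  have := Module.Finite.of_basis (he.basis (restrictπ A.X U))
  have := Module.Free.of_basis (he.basis (restrictπ A.X U))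
  exact IsMinimalPolynomial.exists_of_isIntegrallyClosed _

/-- Pullback along a dominant morphism of integral schemes keeps minimal polynomials. -/
lemma IsFrame.isMinimalPolynomial_comp {V W T : Over S} {n : ℕ} {e : Fin n → (V ⟶ A.X)}
    (he : A.IsFrame e) [IsIntegral W.left] [IsIntegral T.left] (h : W ⟶ V) {a : W ⟶ A.X}
    {μ : Γ(W.left, ⊤)[X]} (hμ : IsMinimalPolynomial a μ) (g : T ⟶ W) [IsDominant g.left] :
    IsMinimalPolynomial (g ≫ a) (μ.map (pullbackFun g)) :=
  hμ.map (pullbackFun g) (pullbackFun_injective g) (A.precomp g) (A.precomp_smul g)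
    (he.basis h) (he.basis (g ≫ h)) fun j ↦ by simp

/-- The polynomial `μ`, whose coefficients are functions on `A`, is the minimal polynomial of the
generic point of `A`, i.e. of all the dominant points of `A` with values in integral schemes. -/
def IsGenericPolynomial (A : AlgebraScheme S) (μ : Γ(A.X.left, ⊤)[X]) : Prop :=
  ∀ (T : Over S) [IsIntegral T.left] (b : T ⟶ A.X) [IsDominant b.left],
    IsMinimalPolynomial b (μ.map (pullbackFun b))

/-- Polynomials of bounded degree on the restrictions of `T` to an open cover of `S`, agreeing on
overlaps, glue to a polynomial over the functions on `T`. -/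
lemma exists_polynomial_of_restrict {T : Over S} {U : S → S.Opens} (hU : ∀ s, s ∈ U s)
    (μ : ∀ s, Γ((restrictTo T (U s)).left, ⊤)[X]) (N : ℕ) (hN : ∀ s, (μ s).natDegree ≤ N)
    (hμ : ∀ s t, (μ s).map (pullbackFun (restrictOfLE T (inf_le_left : U s ⊓ U t ≤ U s))) =
      (μ t).map (pullbackFun (restrictOfLE T (inf_le_right : U s ⊓ U t ≤ U t)))) :
    ∃ ν : Γ(T.left, ⊤)[X], ∀ s, ν.map (pullbackFun (restrictι T (U s))) = μ s := by
  have h (k : ℕ) := exists_fun_of_restrict hU (fun s ↦ (μ s).coeff k) fun s t ↦ by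
    simpa using congrArg (coeff · k) (hμ s t)
  choose c hc using h
  refine ⟨∑ k ∈ Finset.range (N + 1), monomial k (c k), fun s ↦ ?_⟩
  simp_rw [Polynomial.map_sum, map_monomial, hc]
  exact ((μ s).as_sum_range' _ (Nat.lt_succ_of_le (hN s))).symm

/-- The minimal polynomial of a point may be recognized on a nonempty open. -/
lemma isMinimalPolynomial_of_restrict {T : Over S} (U : S.Opens) [IsIntegral T.left]
    [Nonempty (restrictTo T U).left] {b : T ⟶ A.X} {μ : Γ(T.left, ⊤)[X]} (hb : aeval b μ = 0)
    (h : IsMinimalPolynomial (restrictι T U ≫ b) (μ.map (pullbackFun (restrictι T U)))) :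
    IsMinimalPolynomial b μ := by
  have hinj := pullbackFun_injective (restrictι T U)
  have hmonic := monic_of_injective hinj h.monic
  refine ⟨hmonic, hb, fun P hP ↦ ?_⟩
  rw [← map_dvd_map _ hinj hmonic]
  refine h.dvd_of_aeval_eq_zero _ ?_
  rw [← A.comp_aeval, hP, ← precomp_apply, map_zero]

/-- An algebra scheme over a normal integral scheme has a generic minimal polynomial: locally it
exists because the total space of `A` is normal, and the local ones agree on overlaps. -/
lemma IsOfDim.exists_isGenericPolynomial [IsIntegral S] [IsNormalScheme S] {n : ℕ}
    (hA : A.IsOfDim n) : ∃ μ : Γ(A.X.left, ⊤)[X], A.IsGenericPolynomial μ := by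
  have := hA.isIntegral
  choose U hsU hU e he using hA.exists_isAffineOpen
  have hU0 (s : S) : (U s : Set S).Nonempty := ⟨s, hsU s⟩
  have hint (s : S) := (he s).isIntegral_restrictTo (hU0 s)
  choose ν hν using fun s ↦ (he s).exists_isMinimalPolynomial (hU s) (hU0 s)
  have hmap (s : S) {T : Over S} [IsIntegral T.left] (g : T ⟶ restrictTo A.X (U s))
      [IsDominant g.left] := (he s).isMinimalPolynomial_comp (restrictπ A.X (U s)) (hν s) g
  have hne (s t : S) : Nonempty (restrictTo A.X (U s ⊓ U t)).left :=
    A.nonempty_restrictTo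
      (nonempty_preirreducible_inter (U s).isOpen (U t).isOpen (hU0 s) (hU0 t))
  have hoverlap (s t : S) :
      (ν s).map (pullbackFun (restrictOfLE A.X (inf_le_left : U s ⊓ U t ≤ U s))) =
      (ν t).map (pullbackFun (restrictOfLE A.X (inf_le_right : U s ⊓ U t ≤ U t))) := by
    have := isIntegral_restrictTo A.X (U s ⊓ U t)
    have h (r : S) (hr : U s ⊓ U t ≤ U r) : IsMinimalPolynomial (restrictι A.X (U s ⊓ U t))
        ((ν r).map (pullbackFun (restrictOfLE A.X hr))) := by
      have h1 : restrictOfLE A.X hr ≫ restrictι A.X (U r) = restrictι A.X (U s ⊓ U t) := by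
        ext1
        exact A.X.left.homOfLE_ι (A.X.hom.preimage_mono hr)
      have : IsDominant (restrictOfLE A.X hr ≫ restrictι A.X (U r)).left := by
        rw [h1]
        infer_instance
      have := isDominant_of_comp_restrictι (restrictOfLE A.X hr)
      exact h1 ▸ hmap r (restrictOfLE A.X hr)
    exact (h s inf_le_left).unique (h t inf_le_right)
  let s₀ : S := Classical.arbitrary S
  have hdeg (s : S) : (ν s).natDegree ≤ (ν s₀).natDegree := by
    have := isIntegral_restrictTo A.X (U s ⊓ U s₀)
    have h := congrArg natDegree (hoverlap s s₀)
    rw [(hν s).monic.natDegree_map, (hν s₀).monic.natDegree_map] at h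
    exact h.le
  obtain ⟨μ, hμ⟩ := exists_polynomial_of_restrict hsU ν _ hdeg hoverlap
  have hid : aeval (𝟙 A.X) μ = 0 := by
    refine hom_ext_of_restrict fun s ↦ ⟨U s, hsU s, ?_⟩
    rw [A.comp_aeval, Category.comp_id, hμ, (hν s).aeval_eq_zero, ← precomp_apply, map_zero]
  refine ⟨μ, fun T _ b _ ↦ ?_⟩
  have hne' : Nonempty (restrictTo T (U s₀)).left := by
    obtain ⟨t, ht⟩ := b.left.denseRange.exists_mem_open (A.X.hom ⁻¹ᵁ U s₀).isOpen
      (by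
        obtain ⟨x⟩ := A.nonempty_restrictTo (hU0 s₀)
        exact ⟨x.1, x.2⟩)
    refine ⟨⟨t, ?_⟩⟩
    change T.hom t ∈ U s₀
    rw [← Over.w b]
    exact ht
  have := isIntegral_restrictTo T (U s₀)
  have hdom : IsDominant (restrictMap b (U s₀) ≫ restrictι A.X (U s₀)).left := by
    rw [restrictMap_ι]
    exact inferInstanceAs (IsDominant ((restrictι T (U s₀)).left ≫ b.left))
  have := isDominant_of_comp_restrictι (restrictMap b (U s₀))
  refine isMinimalPolynomial_of_restrict (U s₀) ?_ ?_
  · have h := A.comp_aeval b (𝟙 A.X) μ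
    rwa [hid, Category.comp_id, ← precomp_apply, map_zero, eq_comm] at h
  · have h := hmap s₀ (restrictMap b (U s₀))
    rwa [← hμ, Polynomial.map_map, ← pullbackFun_comp, restrictMap_ι, pullbackFun_comp,
      ← Polynomial.map_map] at h

lemma IsGenericPolynomial.isMinimalPolynomial {μ : Γ(A.X.left, ⊤)[X]}
    (hμ : A.IsGenericPolynomial μ) [IsIntegral A.X.left] :
    IsMinimalPolynomial (𝟙 A.X) μ := by
  have : IsDominant (𝟙 A.X : A.X ⟶ A.X).left := inferInstanceAs (IsDominant (𝟙 A.X.left))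
  have h := hμ A.X (𝟙 A.X)
  rwa [pullbackFun_id, Polynomial.map_id] at h

end AlgebraScheme

/-! ### Degree of algebraicity, homogeneous functions, and the values of a determinant -/

namespace AlgebraScheme

variable {S : Scheme.{u}} {A B : AlgebraScheme S}

open Polynomial

/-- The degree of algebraicity is the degree of the generic minimal polynomial: the powers
`1, a, …, a ^ k` of the generic point are linearly independent for smaller `k`, and otherwise `a ^ k`
is a combination of the lower powers, for the generic point and hence for all points. -/
lemma IsGenericPolynomial.degLE_iff [IsIntegral S] {n : ℕ} (hA : A.IsOfDim n)
    {μ : Γ(A.X.left, ⊤)[X]} (hμ : A.IsGenericPolynomial μ) (k : ℕ) :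
    A.DegLE k ↔ μ.natDegree ≤ k := by
  have := hA.isIntegral
  have hmonic := hμ.isMinimalPolynomial.monic
  refine ⟨fun h ↦ ?_, fun hk T _ a ↦ ?_⟩
  · by_contra! hk
    obtain ⟨U, hs, hU, e, he⟩ := hA.exists_isAffineOpen (Classical.arbitrary S)
    have := he.isIntegral_restrictTo ⟨_, hs⟩
    have := he.isAffine_restrictTo hU
    have := Module.Free.of_basis (he.basis (restrictπ A.X U))
    have hmin := hμ _ (restrictι A.X U)
    rw [← hmonic.natDegree_map (pullbackFun (restrictι A.X U))] at hk
    exact exteriorPower_ιMulti_ne_zero (hmin.linearIndependent_pow hk) (h _ (restrictι A.X U))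
  · set Q : Γ(A.X.left, ⊤)[X] := Polynomial.X ^ (k - μ.natDegree) * μ with hQ
    have hQdeg : Q.natDegree = k := by
      rw [hQ, (monic_X_pow _).natDegree_mul hmonic, natDegree_X_pow, Nat.sub_add_cancel hk]
    have hQmonic : Q.Monic := (monic_X_pow _).mul hmonic
    have h := congrArg (A.precomp a) (show aeval (𝟙 A.X) Q = 0 by
      rw [hQ, map_mul, hμ.isMinimalPolynomial.aeval_eq_zero, mul_zero])
    rw [map_zero, aeval_eq_sum_range, hQdeg, Finset.sum_range_succ, map_add, map_sum,
      ← hQdeg, hQmonic.coeff_natDegree, hQdeg, one_smul, add_comm, add_eq_zero_iff_eq_neg] at h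
    refine exteriorPower_ιMulti_pow_eq_zero (fun i ↦ -pullbackFun a (Q.coeff i)) ?_
    simp_rw [precomp_smul, map_pow, precomp_apply, Category.comp_id] at h
    rw [h, Finset.sum_range, ← Finset.sum_neg_distrib]
    simp_rw [neg_smul]

lemma IsGenericPolynomial.isLeast [IsIntegral S] {n : ℕ} (hA : A.IsOfDim n)
    {μ : Γ(A.X.left, ⊤)[X]} (hμ : A.IsGenericPolynomial μ) :
    IsLeast {k : ℕ | A.DegLE k} μ.natDegree :=
  ⟨(hμ.degLE_iff hA _).mpr le_rfl, fun k hk ↦ (hμ.degLE_iff hA k).mp hk⟩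

/-- The function `δ` is a homogeneous polynomial of degree `d` in the coordinates of the
`V`-points `e₁, …, eₙ` of `A`. -/
def IsHomogeneousIn {V : Over S} {n : ℕ} (e : Fin n → (V ⟶ A.X)) (d : ℕ) (δ : Γ(A.X.left, ⊤)) :
    Prop :=
  ∃ p : MvPolynomial (Fin n) Γ(V.left, ⊤), p.IsHomogeneous d ∧
    ∀ ⦃T : Over S⦄ (g : T ⟶ V) (c : Fin n → Γ(T.left, ⊤)),
      value δ (∑ i, c i • (g ≫ e i)) = p.eval₂ (pullbackFun g) c

namespace IsHomogeneousIn

variable {V : Over S} {m n d k : ℕ}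

lemma precomp {e : Fin n → (V ⟶ A.X)} {δ : Γ(A.X.left, ⊤)} (h : IsHomogeneousIn e d δ)
    {V' : Over S} (f : V' ⟶ V) : IsHomogeneousIn (fun i ↦ f ≫ e i) d δ := by
  obtain ⟨p, hp, hpv⟩ := h
  refine ⟨p.map (pullbackFun f), hp.map _, fun T g c ↦ ?_⟩
  rw [MvPolynomial.eval₂_map, ← pullbackFun_comp, ← hpv]
  simp

lemma mul {e : Fin n → (V ⟶ A.X)} {δ ε : Γ(A.X.left, ⊤)} (h : IsHomogeneousIn e d δ)
    (h' : IsHomogeneousIn e k ε) : IsHomogeneousIn e (d + k) (δ * ε) := by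
  obtain ⟨p, hp, hpv⟩ := h
  obtain ⟨q, hq, hqv⟩ := h'
  exact ⟨p * q, hp.mul hq, fun T g c ↦ by rw [value_mul, hpv, hqv, MvPolynomial.eval₂_mul]⟩

/-- A homogeneous polynomial in the coordinates of `B` is one in the coordinates of `A`, because a
homomorphism `A ⟶ B` is linear. -/
lemma pullback {e : Fin m → (V ⟶ A.X)} {e' : Fin n → (V ⟶ B.X)} (he' : B.IsFrame e')
    {δ : Γ(B.X.left, ⊤)} (h : IsHomogeneousIn e' d δ) (f : Hom A B) :
    IsHomogeneousIn e d (f.pullback δ) := by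
  obtain ⟨p, hp, hpv⟩ := h
  let M (i : Fin m) (j : Fin n) : Γ(V.left, ⊤) := (he'.basis (𝟙 V)).equivFun (e i ≫ f.hom) j
  let l (j : Fin n) : MvPolynomial (Fin m) Γ(V.left, ⊤) :=
    ∑ i, MvPolynomial.C (M i j) * MvPolynomial.X i
  refine ⟨p.eval₂ MvPolynomial.C l, ?_, fun T g c ↦ ?_⟩
  · have hl (j : Fin n) : (l j).IsHomogeneous 1 :=
      .sum _ _ _ fun i _ ↦ (MvPolynomial.isHomogeneous_X _ i).C_mul _
    simpa using hp.eval₂ MvPolynomial.C l (fun r ↦ MvPolynomial.isHomogeneous_C _ r) hl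
  · have h1 : (∑ i, c i • (g ≫ e i)) ≫ f.hom =
        ∑ j, (∑ i, pullbackFun g (M i j) * c i) • (g ≫ e' j) := by
      have h2 (i : Fin m) : g ≫ e i ≫ f.hom = ∑ j, pullbackFun g (M i j) • (g ≫ e' j) := by
        conv_lhs => rw [← he'.sum_coord (𝟙 V) (e i ≫ f.hom), B.comp_sum]
        simp_rw [B.comp_smul, Category.id_comp]
        rfl
      have h3 : (∑ i, c i • (g ≫ e i)) ≫ f.hom = ∑ i, c i • (g ≫ e i ≫ f.hom) := by
        exact (map_sum (f.onPoints T) (fun i ↦ c i • (g ≫ e i)) Finset.univ).trans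
          (Finset.sum_congr rfl fun i _ ↦ f.map_smul (c i) (g ≫ e i))
      rw [h3]
      simp_rw [h2, Finset.smul_sum, Finset.sum_smul, smul_smul]
      rw [Finset.sum_comm]
      exact Finset.sum_congr rfl fun j _ ↦ Finset.sum_congr rfl fun i _ ↦ by rw [mul_comm]
    rw [value_pullback, h1, hpv]
    have h4 := MvPolynomial.eval₂_comp_left (MvPolynomial.eval₂Hom (pullbackFun g) c)
      MvPolynomial.C l p
    refine Eq.trans ?_ h4.symm
    congr 1
    · ext x
      simp
    · ext j
      simp [l]

end IsHomogeneousIn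

/-- The identity homomorphism of an algebra scheme. -/
def Hom.id (A : AlgebraScheme S) : Hom A A where
  hom := 𝟙 A.X
  map_add _ _ := by simp
  map_mul _ _ := by simp
  map_one := by simp
  map_smul _ _ := by simp

lemma Hom.id_pullback (δ : Γ(A.X.left, ⊤)) : (Hom.id A).pullback δ = δ := by
  rw [← value_id ((Hom.id A).pullback δ), value_pullback, Category.id_comp]
  exact value_id δ

/-- Around a given point, the pullback of a section of `Sym^d(B^∨)` along `A ⟶ B` is homogeneous in
the coordinates of any given points of `A`. -/
lemma IsSymSection.exists_isHomogeneousIn {d : ℕ} {δ : Γ(B.X.left, ⊤)} (h : B.IsSymSection d δ)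
    (f : Hom A B) {U : S.Opens} {n : ℕ} (e : Fin n → (Over.mk U.ι ⟶ A.X)) {s : S} (hs : s ∈ U) :
    ∃ (U' : S.Opens) (hU' : U' ≤ U), s ∈ U' ∧ IsAffineOpen U' ∧
      IsHomogeneousIn (fun i ↦ opensHom hU' ≫ e i) d (f.pullback δ) := by
  obtain ⟨U₁, hs₁, m, e', he', p, hp, hpv⟩ := h s
  obtain ⟨_, ⟨U', hU', rfl⟩, hs', hU'U : U' ≤ U ⊓ U₁⟩ :=
    S.isBasis_affineOpens.exists_subset_of_mem_open
      (show s ∈ ((U ⊓ U₁ : S.Opens) : Set S) from ⟨hs, hs₁⟩) (U ⊓ U₁).isOpen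
  have h1 : IsHomogeneousIn e' d δ := ⟨p, hp, hpv⟩
  exact ⟨U', hU'U.trans inf_le_left, hs', hU',
    (h1.precomp (opensHom (hU'U.trans inf_le_right))).pullback (he'.precomp _) f⟩

lemma IsSymSection.of_isHomogeneousIn {d : ℕ} {δ : Γ(A.X.left, ⊤)}
    (h : ∀ s : S, ∃ U : S.Opens, s ∈ U ∧ ∃ (n : ℕ) (e : Fin n → (Over.mk U.ι ⟶ A.X)),
      A.IsFrame e ∧ IsHomogeneousIn e d δ) : A.IsSymSection d δ :=
  h

/-- The frame in the definition of a section of `Sym^d(A^∨)` may be taken with the length `n` and over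
an affine open. -/
lemma IsSymSection.exists_isFrame {n d : ℕ} (hA : A.IsOfDim n) {δ : Γ(A.X.left, ⊤)}
    (h : A.IsSymSection d δ) (s : S) :
    ∃ U : S.Opens, s ∈ U ∧ IsAffineOpen U ∧ ∃ e : Fin n → (Over.mk U.ι ⟶ A.X), A.IsFrame e ∧
      IsHomogeneousIn e d δ := by
  obtain ⟨U, hs, e, he⟩ := hA s
  obtain ⟨U', hU', hs', hU'a, h'⟩ := h.exists_isHomogeneousIn (Hom.id A) e hs
  rw [Hom.id_pullback] at h'
  exact ⟨U', hs', hU'a, _, he.precomp _, h'⟩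

/-- Over an affine open with a frame, functions are polynomials, so a factor of a homogeneous
function is homogeneous if the other factor is. -/
lemma IsHomogeneousIn.of_mul [IsIntegral S] {U : S.Opens} {n d k : ℕ}
    {e : Fin n → (Over.mk U.ι ⟶ A.X)} (he : A.IsFrame e) (hU : IsAffineOpen U)
    (hU0 : (U : Set S).Nonempty) {δ ε : Γ(A.X.left, ⊤)} (hmul : IsHomogeneousIn e d (ε * δ))
    (hδ : IsHomogeneousIn e k δ) (hδ0 : pullbackFun (restrictι A.X U) δ ≠ 0) :
    IsHomogeneousIn e (d - k) ε := by
  have : Nonempty U := hU0.to_subtype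
  have : IsIntegral (U : Scheme.{u}) := isIntegral_of_isOpenImmersion U.ι
  have : IsIntegral (Over.mk U.ι).left := this
  obtain ⟨p, hp, hpv⟩ := hmul
  obtain ⟨r, hr, hrv⟩ := hδ
  have hbij : Function.Bijective fun p : MvPolynomial (Fin n) Γ((Over.mk U.ι).left, ⊤) ↦
      p.eval₂ (pullbackFun (restrictπ A.X U)) he.coords := he.bijective_eval₂_coords hU
  obtain ⟨q, hq⟩ := hbij.2 (pullbackFun (restrictι A.X U) ε)
  have hval {γ : Γ(A.X.left, ⊤)} {t : MvPolynomial (Fin n) Γ((Over.mk U.ι).left, ⊤)}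
      (ht : ∀ ⦃T : Over S⦄ (g : T ⟶ Over.mk U.ι) (c : Fin n → Γ(T.left, ⊤)),
        value γ (∑ i, c i • (g ≫ e i)) = t.eval₂ (pullbackFun g) c) :
      t.eval₂ (pullbackFun (restrictπ A.X U)) he.coords = pullbackFun (restrictι A.X U) γ := by
    rw [← ht]
    exact congrArg (value γ) (he.sum_coord (restrictπ A.X U) (restrictι A.X U))
  have hpq : q * r = p := by
    apply hbij.1
    dsimp only at hq ⊢
    rw [MvPolynomial.eval₂_mul, hq, hval hrv, hval hpv, map_mul]
  have hr0 : r ≠ 0 := by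
    rintro rfl
    exact hδ0 (by rw [← hval hrv, MvPolynomial.eval₂_zero])
  refine ⟨q, hr.of_mul_right hr0 (hpq ▸ hp), fun T g c ↦ ?_⟩
  have h1 := restrictLift_ι (∑ i, c i • (g ≫ e i)) g
  rw [← h1]
  have h2 : value ε (restrictι A.X U) = _ := hq.symm
  rw [value_comp, h2, MvPolynomial.eval₂_comp_left, ← pullbackFun_comp]
  congr 1
  · rw [Subsingleton.elim (_ ≫ restrictπ A.X U)]
  · exact funext fun i ↦ he.coords_lift g c i

lemma IsDeterminant.natDegree_eq [IsIntegral S] {n d : ℕ} (hA : A.IsOfDim n)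
    {μ : Γ(A.X.left, ⊤)[X]} (hμ : A.IsGenericPolynomial μ) {δ : Γ(A.X.left, ⊤)}
    (hδ : A.IsDeterminant d δ) : μ.natDegree = d :=
  (hμ.isLeast hA).unique hδ.isLeast

/-- If `δ` is homogeneous of degree `d` and `δ(1) = 1`, then `δ(X - a)` is a monic polynomial of
degree `d`. -/
lemma IsHomogeneousIn.natDegree_le_and_coeff_eq_one {V W : Over S} [IsAffine W.left] {n d : ℕ}
    {e : Fin n → (V ⟶ A.X)} (he : A.IsFrame e) (g : W ⟶ V) {δ : Γ(A.X.left, ⊤)}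
    (h : IsHomogeneousIn e d δ) (h1 : value δ (1 : W ⟶ A.X) = 1) (a : W ⟶ A.X)
    {P : Γ(W.left, ⊤)[X]} (hP : P.eval₂ (pullbackFun (lineProj W)) (lineCoord W) =
      value δ (lineCoord W • (1 : line W ⟶ A.X) - lineProj W ≫ a)) :
    P.natDegree ≤ d ∧ P.coeff d = 1 := by
  obtain ⟨p, hp, hpv⟩ := h
  let b := (he.basis g).equivFun
  have hlin := hp.eval₂_linear (pullbackFun g) (b 1) (b a)
  have hPp : P = p.eval₂ (C.comp (pullbackFun g)) fun i ↦ .C (b 1 i) * .X - .C (b a i) := by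
    apply injective_eval₂_lineCoord W
    dsimp only
    have h2 := MvPolynomial.eval₂_comp_left
      (eval₂RingHom (pullbackFun (lineProj W)) (lineCoord W))
      (C.comp (pullbackFun g)) (fun i ↦ .C (b 1 i) * .X - .C (b a i)) p
    refine (hP.trans ?_).trans h2.symm
    have h3 (x : W ⟶ A.X) : lineProj W ≫ x =
        ∑ i, pullbackFun (lineProj W) (b x i) • ((lineProj W ≫ g) ≫ e i) := by
      conv_lhs => rw [← he.sum_coord g x, A.comp_sum]
      simp_rw [A.comp_smul, Category.assoc]
      rfl
    rw [← A.comp_one (lineProj W), h3, h3, Finset.smul_sum, ← Finset.sum_sub_distrib]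
    simp_rw [smul_smul, ← sub_smul]
    rw [hpv, pullbackFun_comp]
    congr 1
    · refine RingHom.ext fun x ↦ ?_
      rw [RingHom.comp_apply, RingHom.comp_apply, RingHom.comp_apply, coe_eval₂RingHom, eval₂_C]
    · refine funext fun i ↦ ?_
      rw [Function.comp_apply, coe_eval₂RingHom, eval₂_sub, eval₂_mul, eval₂_X, eval₂_C, eval₂_C,
        mul_comm]
  rw [hPp]
  refine ⟨hlin.1, hlin.2.trans ?_⟩
  rw [← hpv, ← h1]
  exact congrArg (value δ) (he.sum_coord g 1)

/-- The value `δ(x - a)` of a determinant is the value at `x` of the generic minimal polynomial. -/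
lemma IsDeterminant.value_smul_one_sub [IsIntegral S] {n d : ℕ} (hA : A.IsOfDim n)
    {μ : Γ(A.X.left, ⊤)[X]} (hμ : A.IsGenericPolynomial μ) {δ : Γ(A.X.left, ⊤)}
    (hδ : A.IsDeterminant d δ) {T : Over S} (a : T ⟶ A.X) (x : Γ(T.left, ⊤)) :
    value δ (x • 1 - a) = (μ.map (pullbackFun a)).eval x := by
  have := hA.isIntegral
  refine fun_ext_of_restrict fun s ↦ ?_
  obtain ⟨U, hs, hU, e, he, hhom⟩ := hδ.isSymSection.exists_isFrame hA s
  refine ⟨U, hs, ?_⟩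
  have := he.isIntegral_restrictTo ⟨s, hs⟩
  have := he.isAffine_restrictTo hU
  set W := restrictTo A.X U
  set i : W ⟶ A.X := restrictι A.X U
  obtain ⟨P, hP, hPi⟩ := hδ.isCancelling W i
  obtain ⟨hdeg, hcoeff⟩ := hhom.natDegree_le_and_coeff_eq_one he (restrictπ A.X U)
    (hδ.isMonoidMorphism W).1 i hP
  have hmin := hμ W i
  have hPμ : μ.map (pullbackFun i) = P := by
    refine (eq_of_monic_of_dvd_of_natDegree_le hmin.monic
      (monic_of_natDegree_le_of_coeff_eq_one d hdeg hcoeff)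
      (hmin.dvd_of_aeval_eq_zero P hPi) ?_).symm
    rwa [hμ.isMinimalPolynomial.monic.natDegree_map, hδ.natDegree_eq hA hμ]
  set r := restrictι T U
  set g : restrictTo T U ⟶ W := restrictMap a U
  have hg : g ≫ i = r ≫ a := restrictMap_ι a U
  set y := pullbackFun r x
  have h1 := congrArg (pullbackFun (lineLift g y)) hP
  rw [← value_comp, A.comp_sub, A.comp_smul, A.comp_one, ← Category.assoc, lineLift_proj,
    hom_eval₂, ← pullbackFun_comp, lineLift_proj, hg] at h1
  change eval₂ (pullbackFun g) (pullbackFun (lineLift g y) (lineCoord W)) P =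
    value δ (pullbackFun (lineLift g y) (lineCoord W) • 1 - r ≫ a) at h1
  rw [pullbackFun_lineLift, ← hPμ, eval₂_map, ← pullbackFun_comp, hg, pullbackFun_comp] at h1
  rw [← value_comp, A.comp_sub, A.comp_smul, A.comp_one]
  refine h1.symm.trans ?_
  rw [Polynomial.eval_map, hom_eval₂]

end AlgebraScheme

/-! ### Quotients and products -/

lemma MvPolynomial.IsHomogeneous.eval₂_mul_left {R D σ : Type*} [CommRing R] [CommRing D]
    (φ : R →+* D) {d : ℕ} {p : MvPolynomial σ R} (hp : p.IsHomogeneous d) (x : D) (c : σ → D) :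
    p.eval₂ φ (fun i ↦ x * c i) = x ^ d * p.eval₂ φ c := by
  rw [eval₂_eq, eval₂_eq, Finset.mul_sum]
  refine Finset.sum_congr rfl fun m hm ↦ ?_
  simp_rw [mul_pow]
  rw [Finset.prod_mul_distrib, Finset.prod_pow_eq_pow_sum, ← hp.degree_eq_sum_deg_support hm]
  ring

namespace AlgebraScheme

variable {S : Scheme.{u}} {A B : AlgebraScheme S}

open Polynomial MonoidalCategory CartesianMonoidalCategory

lemma IsSymSection.value_smul {d : ℕ} {δ : Γ(A.X.left, ⊤)} (h : A.IsSymSection d δ) {T : Over S}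
    (x : Γ(T.left, ⊤)) (a : T ⟶ A.X) : value δ (x • a) = x ^ d * value δ a := by
  refine fun_ext_of_restrict fun s ↦ ?_
  obtain ⟨U, hs, n, e, he, p, hp, hpv⟩ := h s
  refine ⟨U, hs, ?_⟩
  rw [map_mul, map_pow, ← value_comp, ← value_comp, A.comp_smul]
  set y := pullbackFun (restrictι T U) x
  change value δ (y • _) = _
  rw [← he.sum_coord (restrictπ T U) (restrictι T U ≫ a), Finset.smul_sum]
  simp_rw [smul_smul]
  rw [hpv, hpv, hp.eval₂_mul_left]

namespace IsMonoidMorphism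

lemma mul {δ ε : Γ(A.X.left, ⊤)} (hδ : A.IsMonoidMorphism δ) (hε : A.IsMonoidMorphism ε) :
    A.IsMonoidMorphism (δ * ε) := fun T ↦
  ⟨by rw [value_mul, (hδ T).1, (hε T).1, mul_one], fun a b ↦ by
    rw [value_mul, value_mul, value_mul, (hδ T).2, (hε T).2, mul_mul_mul_comm]⟩

lemma pullback {δ : Γ(B.X.left, ⊤)} (hδ : B.IsMonoidMorphism δ) (f : Hom A B) :
    A.IsMonoidMorphism (f.pullback δ) := fun T ↦
  ⟨by rw [value_pullback, f.map_one, (hδ T).1], fun a b ↦ by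
    rw [value_pullback, f.map_mul, (hδ T).2, value_pullback, value_pullback]⟩

/-- A function which is `1` at some point, here at the unit section, is not zero. -/
lemma value_ne_zero [IsIntegral S] {δ : Γ(A.X.left, ⊤)} (hδ : A.IsMonoidMorphism δ) {T : Over S}
    {a : T ⟶ A.X} (r : Over.mk (𝟙 S) ⟶ T) (hr : r ≫ a = 1) : value δ a ≠ 0 := by
  intro h
  have h1 := value_comp δ r a
  rw [hr, (hδ _).1, h, map_zero] at h1
  have : Nontrivial Γ((Over.mk (𝟙 S)).left, ⊤) := inferInstanceAs (Nontrivial Γ(S, ⊤))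
  exact one_ne_zero h1

lemma ne_zero [IsIntegral S] {δ : Γ(A.X.left, ⊤)} (hδ : A.IsMonoidMorphism δ) : δ ≠ 0 := by
  rw [← value_id δ]
  exact hδ.value_ne_zero 1 (Category.comp_id _)

end IsMonoidMorphism

section product

lemma prod_hom_ext {T : Over S} {x y : T ⟶ (A.prod B).X}
    (h₁ : x ≫ (A.prodFst B).hom = y ≫ (A.prodFst B).hom)
    (h₂ : x ≫ (A.prodSnd B).hom = y ≫ (A.prodSnd B).hom) : x = y :=
  CartesianMonoidalCategory.hom_ext _ _ h₁ h₂

/-- The point of `A × B` with given components. -/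
def prodLift {T : Over S} (a : T ⟶ A.X) (b : T ⟶ B.X) : T ⟶ (A.prod B).X :=
  lift a b

lemma prodLift_fst {T : Over S} (a : T ⟶ A.X) (b : T ⟶ B.X) :
    prodLift a b ≫ (A.prodFst B).hom = a :=
  lift_fst a b

lemma prodLift_snd {T : Over S} (a : T ⟶ A.X) (b : T ⟶ B.X) :
    prodLift a b ≫ (A.prodSnd B).hom = b :=
  lift_snd a b

instance : IsDominant (A.prodFst B).hom.left :=
  have : IsDominant ((prodLift (𝟙 A.X) (0 : A.X ⟶ B.X)).left ≫ (A.prodFst B).hom.left) := by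
    rw [← Over.comp_left, prodLift_fst]
    exact inferInstanceAs (IsDominant (𝟙 A.X.left))
  .of_comp (prodLift (𝟙 A.X) (0 : A.X ⟶ B.X)).left _

instance : IsDominant (A.prodSnd B).hom.left :=
  have : IsDominant ((prodLift (0 : B.X ⟶ A.X) (𝟙 B.X)).left ≫ (A.prodSnd B).hom.left) := by
    rw [← Over.comp_left, prodLift_snd]
    exact inferInstanceAs (IsDominant (𝟙 B.X.left))
  .of_comp (prodLift (0 : B.X ⟶ A.X) (𝟙 B.X)).left _

/-- The points of the product algebra are the pairs of points, linearly. -/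
def prodPointsLinearEquiv (A B : AlgebraScheme S) (T : Over S) :
    (T ⟶ (A.prod B).X) ≃ₗ[Γ(T.left, ⊤)] (T ⟶ A.X) × (T ⟶ B.X) :=
  .ofBijective (((A.prodFst B).onPoints T).prod ((A.prodSnd B).onPoints T)).toLinearMap
    (prodPoints A B T).bijective

lemma prodPointsLinearEquiv_symm_apply {T : Over S} (a : T ⟶ A.X) (b : T ⟶ B.X) :
    (prodPointsLinearEquiv A B T).symm (a, b) = prodLift a b := by
  rw [LinearEquiv.symm_apply_eq]
  exact Prod.ext (prodLift_fst a b).symm (prodLift_snd a b).symm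

/-- Frames of `A` and `B` together give a frame of `A × B`. -/
lemma IsFrame.prod {V : Over S} {m n : ℕ} {e : Fin m → (V ⟶ A.X)} {e' : Fin n → (V ⟶ B.X)}
    (he : A.IsFrame e) (he' : B.IsFrame e') :
    (A.prod B).IsFrame (Fin.append (fun i ↦ prodLift (e i) 0) fun j ↦ prodLift 0 (e' j)) := by
  intro T g
  let b := (((he.basis g).prod (he'.basis g)).map (prodPointsLinearEquiv A B T).symm).reindex
    finSumFinEquiv
  have hb (i : Fin (m + n)) :
      b i = g ≫ Fin.append (fun i ↦ prodLift (e i) 0) (fun j ↦ prodLift 0 (e' j)) i := by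
    refine Fin.addCases (fun i ↦ ?_) (fun j ↦ ?_) i
    · simp only [b, Module.Basis.reindex_apply, Module.Basis.map_apply,
        finSumFinEquiv_symm_apply_castAdd, Fin.append_left, Module.Basis.prod_apply, Sum.elim_inl,
        Function.comp_apply, LinearMap.inl_apply, prodPointsLinearEquiv_symm_apply, basis_apply]
      refine prod_hom_ext ?_ ?_
      · rw [prodLift_fst, Category.assoc, prodLift_fst]
      · rw [prodLift_snd, Category.assoc, prodLift_snd]
        exact (map_zero (B.precomp g)).symm
    · simp only [b, Module.Basis.reindex_apply, Module.Basis.map_apply,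
        finSumFinEquiv_symm_apply_natAdd, Fin.append_right, Module.Basis.prod_apply, Sum.elim_inr,
        Function.comp_apply, LinearMap.inr_apply, prodPointsLinearEquiv_symm_apply, basis_apply]
      refine prod_hom_ext ?_ ?_
      · rw [prodLift_fst, Category.assoc, prodLift_fst]
        exact (map_zero (A.precomp g)).symm
      · rw [prodLift_snd, Category.assoc, prodLift_snd]
  rw [← funext hb]
  exact ⟨b.linearIndependent, b.span_eq⟩

lemma IsOfDim.prod {m n : ℕ} (hA : A.IsOfDim m) (hB : B.IsOfDim n) :
    (A.prod B).IsOfDim (m + n) := by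
  intro s
  obtain ⟨U, hU, e, he⟩ := hA s
  obtain ⟨V, hV, e', he'⟩ := hB s
  exact ⟨U ⊓ V, ⟨hU, hV⟩, _,
    (he.precomp (opensHom inf_le_left)).prod (he'.precomp (opensHom inf_le_right))⟩

end product

/-- A factor of a monoid morphism is a monoid morphism, if the other factor is: the identity
`ε(x y) = ε(x) ε(y)` for the universal pair of points follows by cancellation on the integral scheme
`A × A`. -/
lemma IsMonoidMorphism.of_mul [IsIntegral S] [IsIntegral (A.prod A).X.left]
    {δ ε : Γ(A.X.left, ⊤)} (hδ : A.IsMonoidMorphism δ) (h : A.IsMonoidMorphism (ε * δ)) :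
    A.IsMonoidMorphism ε := by
  have hone (T : Over S) : value ε (1 : T ⟶ A.X) = 1 := by
    simpa [value_mul, (hδ T).1] using (h T).1
  let x := (A.prodFst A).hom
  let y := (A.prodSnd A).hom
  have huniv : value ε (x * y) = value ε x * value ε y := by
    have hx : value δ x ≠ 0 := hδ.value_ne_zero (prodLift 1 1) (prodLift_fst _ _)
    have hy : value δ y ≠ 0 := hδ.value_ne_zero (prodLift 1 1) (prodLift_snd _ _)
    have h1 := (h _).2 x y
    rw [value_mul, value_mul, value_mul, (hδ _).2, mul_mul_mul_comm] at h1
    exact mul_right_cancel₀ (mul_ne_zero hx hy) h1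
  refine fun T ↦ ⟨hone T, fun a b ↦ ?_⟩
  have h1 := congrArg (pullbackFun (prodLift a b)) huniv
  rwa [map_mul, ← value_comp, ← value_comp, ← value_comp, A.comp_mul, prodLift_fst,
    prodLift_snd] at h1

lemma IsDeterminant.value_eq [IsIntegral S] {n d : ℕ} (hA : A.IsOfDim n)
    {μ : Γ(A.X.left, ⊤)[X]} (hμ : A.IsGenericPolynomial μ) {δ : Γ(A.X.left, ⊤)}
    (hδ : A.IsDeterminant d δ) {T : Over S} (a : T ⟶ A.X) :
    value δ a = (μ.map (pullbackFun (-a))).eval 0 := by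
  rw [← hδ.value_smul_one_sub hA hμ, zero_smul, zero_sub, neg_neg]

/-- A determinant is the value at `0` of the generic minimal polynomial of `-a`, so it is unique. -/
lemma IsDeterminant.unique [IsIntegral S] [IsNormalScheme S] {n d k : ℕ} (hA : A.IsOfDim n)
    {δ ε : Γ(A.X.left, ⊤)} (hδ : A.IsDeterminant d δ) (hε : A.IsDeterminant k ε) :
    k = d ∧ ε = δ := by
  obtain ⟨μ, hμ⟩ := hA.exists_isGenericPolynomial
  refine ⟨hε.isLeast.unique hδ.isLeast, ?_⟩
  rw [← value_id ε, ← value_id δ, hε.value_eq hA hμ, hδ.value_eq hA hμ]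

/-- The determinant of a quotient divides the determinant: the generic minimal polynomial of `A`
cancels the generic point of `B`, so it is divisible by the generic minimal polynomial of `B`. -/
lemma IsDeterminant.exists_eq_mul_pullback [IsIntegral S] [IsNormalScheme S] {m n d e : ℕ}
    (hA : A.IsOfDim m) (hB : B.IsOfDim n) (f : Hom A B) [IsDominant f.hom.left]
    {δ : Γ(A.X.left, ⊤)} {ε : Γ(B.X.left, ⊤)} (hδ : A.IsDeterminant d δ)
    (hε : B.IsDeterminant e ε) :
    e ≤ d ∧ ∃ γ : Γ(A.X.left, ⊤), δ = γ * f.pullback ε := by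
  have := hA.isIntegral
  have := hB.isIntegral
  obtain ⟨μ, hμ⟩ := hA.exists_isGenericPolynomial
  obtain ⟨ν, hν⟩ := hB.exists_isGenericPolynomial
  have hμ1 := hμ.isMinimalPolynomial
  have hν1 := hν A.X f.hom
  have hf : aeval f.hom μ = 0 := by
    have h := f.aeval_comp (𝟙 A.X) μ
    rw [hμ1.aeval_eq_zero, Category.id_comp] at h
    exact h.symm.trans (map_zero (f.onPoints A.X))
  obtain ⟨Q, hQ⟩ := hν1.dvd_of_aeval_eq_zero μ hf
  refine ⟨?_, (Q.map (pullbackFun (-𝟙 A.X))).eval 0, ?_⟩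
  · have := natDegree_le_of_dvd (Dvd.intro Q hQ.symm) hμ1.monic.ne_zero
    rwa [hν.isMinimalPolynomial.monic.natDegree_map, hδ.natDegree_eq hA hμ,
      hε.natDegree_eq hB hν] at this
  · have hneg : -f.hom = (-𝟙 A.X) ≫ f.hom := by
      have := map_neg (f.onPoints A.X) (𝟙 A.X)
      exact (congrArg (- ·) (Category.id_comp f.hom).symm).trans this.symm
    have h1 : f.pullback ε = value ε f.hom := rfl
    rw [h1, hε.value_eq hB hν, hneg, pullbackFun_comp, ← Polynomial.map_map, mul_comm, ← eval_mul,
      ← Polynomial.map_mul, ← hQ]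
    conv_lhs => rw [← value_id δ, hδ.value_eq hA hμ]

/-- A factor of a section of `Sym^d(A^∨)` is a section of `Sym^(d - k)(A^∨)`, if the other factor is
the pullback of a section of degree `k` and is not zero. -/
lemma IsSymSection.of_mul [IsIntegral S] {n d k : ℕ} (hA : A.IsOfDim n) {f : Hom A B}
    {γ : Γ(A.X.left, ⊤)} {ε : Γ(B.X.left, ⊤)} (hε : B.IsSymSection k ε) (hε0 : f.pullback ε ≠ 0)
    (h : A.IsSymSection d (γ * f.pullback ε)) : A.IsSymSection (d - k) γ := by
  have := hA.isIntegral
  refine .of_isHomogeneousIn fun s ↦ ?_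
  obtain ⟨U, hs, hU, e, he, he1⟩ := h.exists_isFrame hA s
  obtain ⟨U', hU', hs', hU'a, h'⟩ := hε.exists_isHomogeneousIn f e hs
  have hne : (U' : Set S).Nonempty := ⟨s, hs'⟩
  have := A.nonempty_restrictTo hne
  refine ⟨U', hs', n, _, he.precomp (opensHom hU'), .of_mul (he.precomp _) hU'a hne
    (he1.precomp _) h' ?_⟩
  rwa [map_ne_zero_iff _ (pullbackFun_injective _)]

section product

/-- At the scalar point `c` the generic minimal polynomial is `(X - c) ^ d`, because
`δ(X - c) = (X - c) ^ d δ(1)` by homogeneity. -/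
lemma IsDeterminant.map_smul_one_eq [IsIntegral S] {n d : ℕ} (hA : A.IsOfDim n)
    {μ : Γ(A.X.left, ⊤)[X]} (hμ : A.IsGenericPolynomial μ) {δ : Γ(A.X.left, ⊤)}
    (hδ : A.IsDeterminant d δ) (T : Over S) [IsAffine T.left] (c : Γ(T.left, ⊤)) :
    μ.map (pullbackFun (c • 1 : T ⟶ A.X)) = (Polynomial.X - C c) ^ d := by
  apply injective_eval₂_lineCoord T
  have h := hδ.value_smul_one_sub hA hμ (lineProj T ≫ (c • 1)) (lineCoord T)
  rw [A.comp_smul, A.comp_one] at h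
  change value δ (_ - pullbackFun (lineProj T) c • _) = _ at h
  rw [← sub_smul, hδ.isSymSection.value_smul, (hδ.isMonoidMorphism _).1, mul_one] at h
  have h2 : (lineProj T ≫ (c • 1) : line T ⟶ A.X) = pullbackFun (lineProj T) c • 1 := by
    rw [A.comp_smul, A.comp_one]
  dsimp only
  rw [eval₂_map, ← pullbackFun_comp, h2, ← Polynomial.eval_map, eval₂_pow, eval₂_sub, eval₂_X,
    eval₂_C]
  exact h.symm

/-- The generic minimal polynomials of the two factors of a product are coprime: their resultant is
a function on the product, and at the point `(0, 1)` the polynomials are `X ^ d` and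
`(X - 1) ^ e`. -/
lemma IsDeterminant.resultant_ne_zero [IsIntegral S] {m n d e : ℕ} (hA : A.IsOfDim m)
    (hB : B.IsOfDim n) {μ : Γ(A.X.left, ⊤)[X]} (hμ : A.IsGenericPolynomial μ)
    {ν : Γ(B.X.left, ⊤)[X]} (hν : B.IsGenericPolynomial ν) {δ : Γ(A.X.left, ⊤)}
    {ε : Γ(B.X.left, ⊤)} (hδ : A.IsDeterminant d δ) (hε : B.IsDeterminant e ε) :
    (μ.map (pullbackFun (A.prodFst B).hom)).resultant
      (ν.map (pullbackFun (A.prodSnd B).hom)) ≠ 0 := by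
  have := hA.isIntegral
  have := hB.isIntegral
  have := (hA.prod hB).isIntegral
  obtain ⟨U, hs, hU, -⟩ := hA.exists_isAffineOpen (Classical.arbitrary S)
  have : Nonempty U := ⟨⟨_, hs⟩⟩
  have : IsIntegral (U : Scheme.{u}) := isIntegral_of_isOpenImmersion U.ι
  have : IsIntegral (Over.mk U.ι).left := this
  have : IsAffine (Over.mk U.ι).left := hU
  -- The point `(0, 1)`, with its components written as scalar points, as in `map_smul_one_eq`.
  let c : Over.mk U.ι ⟶ (A.prod B).X :=
    prodLift ((0 : Γ((Over.mk U.ι).left, ⊤)) • 1) ((1 : Γ((Over.mk U.ι).left, ⊤)) • 1)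
  have hμm := hμ.isMinimalPolynomial.monic
  have hνm := hν.isMinimalPolynomial.monic
  set p := μ.map (pullbackFun (A.prodFst B).hom) with hp
  set q := ν.map (pullbackFun (A.prodSnd B).hom) with hq
  have hpc : p.map (pullbackFun c) = (Polynomial.X - C 0) ^ d := by
    rw [hp, Polynomial.map_map, ← pullbackFun_comp, prodLift_fst]
    exact hδ.map_smul_one_eq hA hμ (Over.mk U.ι) 0
  have hqc : q.map (pullbackFun c) = (Polynomial.X - C 1) ^ e := by
    rw [hq, Polynomial.map_map, ← pullbackFun_comp, prodLift_snd]
    exact hε.map_smul_one_eq hB hν (Over.mk U.ι) 1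
  have hcop : IsCoprime (p.map (pullbackFun c)) (q.map (pullbackFun c)) := by
    rw [hpc, hqc]
    exact IsCoprime.pow ⟨1, -1, by simp⟩
  have hunit := (isUnit_resultant_iff_isCoprime ((hμm.map _).map _)).mpr hcop
  rw [(hμm.map _).natDegree_map, (hνm.map _).natDegree_map, resultant_map_map] at hunit
  intro h0
  rw [h0, map_zero] at hunit
  exact not_isUnit_zero hunit

/-- The degree of algebraicity of a product is the sum of those of the factors, because the generic
minimal polynomial of a product is the product of those of the factors. -/
lemma IsDeterminant.isLeast_degLE_prod [IsIntegral S] [IsNormalScheme S] {m n d e : ℕ}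
    (hA : A.IsOfDim m) (hB : B.IsOfDim n) {δ : Γ(A.X.left, ⊤)} {ε : Γ(B.X.left, ⊤)}
    (hδ : A.IsDeterminant d δ) (hε : B.IsDeterminant e ε) :
    IsLeast {k : ℕ | (A.prod B).DegLE k} (d + e) := by
  have hC := hA.prod hB
  have := hA.isIntegral
  have := hB.isIntegral
  have := hC.isIntegral
  obtain ⟨μ, hμ⟩ := hA.exists_isGenericPolynomial
  obtain ⟨ν, hν⟩ := hB.exists_isGenericPolynomial
  obtain ⟨ρ, hρ⟩ := hC.exists_isGenericPolynomial
  have hρ1 := hρ.isMinimalPolynomial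
  have hres := hδ.resultant_ne_zero hA hB hμ hν hε
  have hp := hμ _ (A.prodFst B).hom
  have hq := hν _ (A.prodSnd B).hom
  have hpd : (μ.map (pullbackFun (A.prodFst B).hom)).natDegree = d := by
    rw [hμ.isMinimalPolynomial.monic.natDegree_map, hδ.natDegree_eq hA hμ]
  have hqd : (ν.map (pullbackFun (A.prodSnd B).hom)).natDegree = e := by
    rw [hν.isMinimalPolynomial.monic.natDegree_map, hε.natDegree_eq hB hν]
  set p := μ.map (pullbackFun (A.prodFst B).hom)
  set q := ν.map (pullbackFun (A.prodSnd B).hom)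
  have h1 (P : Γ((A.prod B).X.left, ⊤)[X]) :
      aeval (𝟙 (A.prod B).X) P ≫ (A.prodFst B).hom = aeval (A.prodFst B).hom P := by
    rw [(A.prodFst B).aeval_comp, Category.id_comp]
  have h2 (P : Γ((A.prod B).X.left, ⊤)[X]) :
      aeval (𝟙 (A.prod B).X) P ≫ (A.prodSnd B).hom = aeval (A.prodSnd B).hom P := by
    rw [(A.prodSnd B).aeval_comp, Category.id_comp]
  have hpρ : p ∣ ρ := hp.dvd_of_aeval_eq_zero ρ (by
    rw [← h1, hρ1.aeval_eq_zero]
    exact map_zero ((A.prodFst B).onPoints _))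
  have hqρ : q ∣ ρ := hq.dvd_of_aeval_eq_zero ρ (by
    rw [← h2, hρ1.aeval_eq_zero]
    exact map_zero ((A.prodSnd B).onPoints _))
  have hρpq : ρ ∣ p * q := hρ1.dvd_of_aeval_eq_zero _ (prod_hom_ext
    (by
      rw [h1, map_mul, hp.aeval_eq_zero, zero_mul]
      exact (map_zero ((A.prodFst B).onPoints _)).symm)
    (by
      rw [h2, map_mul, hq.aeval_eq_zero, mul_zero]
      exact (map_zero ((A.prodSnd B).onPoints _)).symm))
  have hpqρ : p * q ∣ ρ := by
    let K := FractionRing Γ((A.prod B).X.left, ⊤)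
    have hinj := IsFractionRing.injective Γ((A.prod B).X.left, ⊤) K
    rw [← map_dvd_map (algebraMap _ K) hinj (hp.monic.mul hq.monic), Polynomial.map_mul]
    refine IsCoprime.mul_dvd ?_ (Polynomial.map_dvd _ hpρ) (Polynomial.map_dvd _ hqρ)
    by_contra hcop
    have h0 := resultant_eq_zero_iff.mpr ⟨.inl (hp.monic.map (algebraMap _ K)).ne_zero, hcop⟩
    rw [hp.monic.natDegree_map, hq.monic.natDegree_map, resultant_map_map] at h0
    exact hres (hinj (h0.trans (map_zero _).symm))
  have hρeq : ρ = p * q := eq_of_monic_of_associated hρ1.monic (hp.monic.mul hq.monic)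
    (associated_of_dvd_dvd hρpq hpqρ)
  have h := hρ.isLeast hC
  rwa [hρeq, hp.monic.natDegree_mul hq.monic, hpd, hqd] at h

lemma IsDeterminant.prod [IsIntegral S] [IsNormalScheme S] {m n d e : ℕ}
    (hA : A.IsOfDim m) (hB : B.IsOfDim n) {δ : Γ(A.X.left, ⊤)} {ε : Γ(B.X.left, ⊤)}
    (hδ : A.IsDeterminant d δ) (hε : B.IsDeterminant e ε) :
    (A.prod B).IsDeterminant (d + e)
      ((A.prodFst B).pullback δ * (A.prodSnd B).pullback ε) where
  isLeast := hδ.isLeast_degLE_prod hA hB hε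
  isSymSection := by
    refine .of_isHomogeneousIn fun s ↦ ?_
    obtain ⟨U, hs, b, hb⟩ := hA.prod hB s
    obtain ⟨U₁, hU₁, hs₁, -, h₁⟩ := hδ.isSymSection.exists_isHomogeneousIn (A.prodFst B) b hs
    obtain ⟨U₂, hU₂, hs₂, -, h₂⟩ := hε.isSymSection.exists_isHomogeneousIn (A.prodSnd B)
      (fun i ↦ opensHom hU₁ ≫ b i) hs₁
    exact ⟨U₂, hs₂, _, _, (hb.precomp _).precomp _, (h₁.precomp (opensHom hU₂)).mul h₂⟩
  isMonoidMorphism := (hδ.isMonoidMorphism.pullback _).mul (hε.isMonoidMorphism.pullback _)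
  isCancelling T _ c := by
    obtain ⟨P, hP, hPc⟩ := hδ.isCancelling T (c ≫ (A.prodFst B).hom)
    obtain ⟨Q, hQ, hQc⟩ := hε.isCancelling T (c ≫ (A.prodSnd B).hom)
    refine ⟨P * Q, ?_, prod_hom_ext ?_ ?_⟩
    · have h {D : AlgebraScheme S} (f : Hom (A.prod B) D) :
          (lineCoord T • (1 : line T ⟶ (A.prod B).X) - lineProj T ≫ c) ≫ f.hom =
            lineCoord T • 1 - lineProj T ≫ c ≫ f.hom := by
        rw [← f.map_one, ← f.map_smul]
        exact map_sub (f.onPoints (line T)) _ _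
      rw [eval₂_mul, hP, hQ, value_mul, value_pullback, value_pullback, h, h]
    · rw [(A.prodFst B).aeval_comp, map_mul, hPc, zero_mul]
      exact (map_zero ((A.prodFst B).onPoints _)).symm
    · rw [(A.prodSnd B).aeval_comp, map_mul, hQc, mul_zero]
      exact (map_zero ((A.prodSnd B).onPoints _)).symm

end product

end AlgebraScheme

end

theorem proposition4p2 (S : Scheme.{u}) [IsIntegral S] [IsNormalScheme S] :
    (∀ (A B : AlgebraScheme S) (m n : ℕ), A.IsOfDim m → B.IsOfDim n →
      ∀ f : AlgebraScheme.Hom A B, Surjective f.hom.left →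
      ∀ (d e : ℕ) (detA : Γ(A.X.left, ⊤)) (detB : Γ(B.X.left, ⊤)),
        A.IsDeterminant d detA → B.IsDeterminant e detB →
        e ≤ d ∧
          ∃ detAB : Γ(A.X.left, ⊤),
            (A.IsSymSection (d - e) detAB ∧ detA = detAB * f.pullback detB) ∧
            (∀ δ : Γ(A.X.left, ⊤),
              A.IsSymSection (d - e) δ ∧ detA = δ * f.pullback detB → δ = detAB) ∧
            A.IsMonoidMorphism detAB) ∧
    (∀ (A B : AlgebraScheme S) (m n : ℕ), A.IsOfDim m → B.IsOfDim n →
      ∀ (d e : ℕ) (detA : Γ(A.X.left, ⊤)) (detB : Γ(B.X.left, ⊤)),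
        A.IsDeterminant d detA → B.IsDeterminant e detB →
        (A.prod B).IsDeterminant (d + e)
          ((A.prodFst B).pullback detA * (A.prodSnd B).pullback detB) ∧
        ∀ (k : ℕ) (detC : Γ((A.prod B).X.left, ⊤)), (A.prod B).IsDeterminant k detC →
          k = d + e ∧
            detC = (A.prodFst B).pullback detA * (A.prodSnd B).pullback detB) := by
  refine ⟨fun A B m n hA hB f _ d e detA detB hdA hdB ↦ ?_,
    fun A B m n hA hB d e detA detB hdA hdB ↦ ?_⟩
  · have := hA.isIntegral
    have := (hA.prod hA).isIntegral
    obtain ⟨hed, detAB, h⟩ := hdA.exists_eq_mul_pullback hA hB f hdB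
    have hmon := hdB.isMonoidMorphism.pullback f
    refine ⟨hed, detAB, ⟨?_, h⟩, fun δ hδ ↦ ?_, hmon.of_mul (h ▸ hdA.isMonoidMorphism)⟩
    · exact .of_mul hA hdB.isSymSection hmon.ne_zero (h ▸ hdA.isSymSection)
    · exact mul_right_cancel₀ hmon.ne_zero (hδ.2.symm.trans h)
  · have hC := hdA.prod hA hB hdB
    exact ⟨hC, fun k detC hdC ↦ hC.unique (hA.prod hB) hdC⟩
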